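/- **Setting.** Let $\lambda\in\mathbb N$ be the security parameter, $L=L(\lambda)$ with $n=2^{L}$ bounded by a polynomial in $\lambda$, and let $B=B(\lambda)$ be a block size. A client outsources $n$ blocks of $B$ bits with addresses $0,\dots,n-1$. A request is $\mathsf{read}(a)$ or $\mathsf{write}(a,\mathsf{data})$. The *access pattern* $A(\vec y)$ on a request sequence $\vec y$ is the random sequence of accesses to the remote storage (read or write, which array, which index; not the contents), listed interaction by interaction. Two ensembles are *computationally indistinguishable* if every family of (non-uniform) Boolean circuits of size polynomial in $\lambda$ distinguishes them with advantage negligible in $\lambda$. A family of keyed permutations of $\{0,1\}^d$ is *pseudorandom* if, for every polynomially bounded $d=d(\lambda)$, no polynomial-size family of oracle circuits distinguishes, with non-negligible advantage, the permutation of a uniformly random key from a uniformly random permutation. **RankORAM.** The server has tables $T_0,\dots,T_L$, where $T_l$ has length $2\cdot 2^l$; level $l$ has a permutation $\pi_l$ of $[2\cdot 2^l]=\{0,\dots,2\cdot 2^l-1\}$ from the pseudorandom family with a fresh random key. The client keeps the set $\Phi_l$ of addresses of each level, a counter $\mathsf{dummyCntr}_l$, and the set of occupied levels. Put $\mathsf{level}(x)=\min\{l: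 x\in\Phi_l\}$, and let the position of $x$ in level $l$ be its rank $|\{y\in\Phi_l:y<x\}|$ if $l<L$, and $x$ if $l=L$; block $x\in\Phi_l$ lies at $T_l[\pi_l(\text{position of }x)]$, and the other cells of $T_l$ are dummies. Initially exactly level $L$ is occupied, $\Phi_L$ is the set of all addresses and $\mathsf{dummyCntr}_L=n$. A request for $a$ is served as follows. 1. *Access.* For every occupied level $i$, in one batch, cell $\pi_i(r)$ of $T_i$ is read, where $r$ is the position of $a$ if $i=\mathsf{level}(a)$, and otherwise $r=\mathsf{dummyCntr}_i$, which is then incremented. 2. *Eviction.* Let $l$ be the smallest unoccupied level, or $l=L$ if all levels below $L$ are occupied. The block $a$ (with the new data in case of a write) is written to an input array, and the untouched cells of the occupied levels $j\le l$, by increasing level and index, are moved to that array. Here a cell of $T_j$ that holds a block $b$ is touched if $b=a$ or $\mathsf{level}(b)<j$, and the dummy with index $\pi_j(r)$ is touched if $r<\mathsf{dummyCntr}_j$. 3. *Shuffle.* $\Phi_l$ becomes $\{a\}\cup\bigcup_{j\le l}\Phi_j$, the sets $\Phi_j$ with $j<l$ become empty, $\pi_l$ is drawn afresh, $\mathsf{dummyCntr}_l$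 becomes $|\Phi_l|$, and a shuffle algorithm, applied to the input array, writes the new $T_l$, with each block at $\pi_l$ of its position and dummies elsewhere. Then level $l$ is occupied and the levels below $l$ are not. A shuffle algorithm is *oblivious* if its access patterns on any two inputs (an array of at most $2\cdot 2^l$ cells, each a key-value pair or a dummy, with distinct keys, together with a permutation of $[2\cdot 2^l]$) with arrays of the same length, $2^l$ being polynomially bounded in $\lambda$, are computationally indistinguishable. The *short queue shuffle* for output length $2\cdot2^l$ uses $q=2^{\lfloor l/2\rfloor}$ buckets and as many client-side queues, and divides a temporary array and the output array into $q$ chunks of length $2\cdot2^l/q$. It assigns the input indices uniformly at random to the buckets, in segments of equal size; in each of $q$ rounds it downloads a bucket, appends each real block to the queue of its destination chunk, and writes $2\cdot2^l/q^2$ cells into every chunk of the temporary array, taken from the queue of the chunk or dummies if the queue is empty; finally, chunk by chunk, it downloads the temporary chunk and uploads the arranged output chunk. **Lemma.** RankORAM, with a pseudorandom family of permutations and any initial database, is oblivious, both with an arbitrary oblivious shuffle algorithm and with the short queue shuffle: for all families of request sequences $\vec y_\lambda$, $\vec z_\lambda$ of the same length, polynomially bounded in $\lambda$, the access patterns $A(\vec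 y_\lambda)$ and $A(\vec z_\lambda)$ (access probes, evictions and shuffles) are computationally indistinguishable. -/

import Mathlib

/-! ### Asymptotics -/

/-- `s` is bounded by a polynomial in the security parameter. -/
def PolyBounded (s : ℕ → ℕ) : Prop :=
  ∃ p : Polynomial ℕ, ∀ sec, s sec ≤ p.eval sec

/-- `ε` vanishes faster than the inverse of every polynomial. -/
def Negligible (ε : ℕ → ℝ) : Prop :=
  Asymptotics.SuperpolynomialDecay Filter.atTop (fun sec : ℕ => (sec : ℝ)) ε

/-- Probability that the Boolean test `f` accepts a sample of `p`. -/
noncomputable def acceptProb {α : Type} (p : PMF α) (f : α → Bool) : ℝ :=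
  ((p.map f) true).toReal

/-! ### Boolean circuits, with or without oracle gates -/

/-- A gate with input labels in `ι` and oracle names in `κ`; `nand` and `query` refer to earlier
wires by their number. A `query` gate outputs one bit of the answer of the oracle. -/
inductive Gate (ι κ : Type) : Type
  | input (i : ι)
  | const (b : Bool)
  | nand (j k : ℕ)
  | query (o : κ) (wires : List ℕ) (bit : ℕ)

/-- A circuit is a list of gates; its size is the length of the list, and its output is the wire of
the last gate. -/
abbrev Circuit (ι κ : Type) : Type := List (Gate ι κ)

/-- The value of a gate, given the values `w` of the earlier wires. -/
def Gate.value {ι κ : Type} (x : ι → Bool) (O : κ → List Bool → ℕ → Bool) (w : List Bool) :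
    Gate ι κ → Bool
  | .input i => x i
  | .const b => b
  | .nand j k => !(w.getD j false && w.getD k false)
  | .query o wires bit => O o (wires.map fun j => w.getD j false) bit

def Circuit.eval {ι κ : Type} (C : Circuit ι κ) (x : ι → Bool) (O : κ → List Bool → ℕ → Bool) :
    Bool :=
  (C.foldl (fun w g => w ++ [g.value x O w]) []).getLastD false

/-- Computational indistinguishability of two ensembles against non-uniform polynomial-size
distinguishers; `bits` is the binary encoding of the samples. -/
def Indistinguishable {α ι : Type} (bits : α → ι → Bool) (X Y : ℕ → PMF α) : Prop :=
  ∀ C : ℕ → Circuit ι Empty, PolyBounded (fun sec => (C sec).length) →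
    Negligible fun sec =>
      |acceptProb (X sec) (fun v => (C sec).eval (bits v) (fun o => o.elim)) -
        acceptProb (Y sec) (fun v => (C sec).eval (bits v) (fun o => o.elim))|

/-! ### Pseudorandom permutations -/

/-- A family of keyed permutations of the domains `{0,1}^d`, for every security parameter. -/
structure PermFamily where
  Key : ℕ → ℕ → Type
  [fintypeKey : ∀ sec d, Fintype (Key sec d)]
  [nonemptyKey : ∀ sec d, Nonempty (Key sec d)]
  perm : ∀ sec d, Key sec d → Equiv.Perm (Fin (2 ^ d))

attribute [instance] PermFamily.fintypeKey PermFamily.nonemptyKey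

/-- The permutation of a freshly sampled key. -/
noncomputable def PermFamily.fresh (F : PermFamily) (sec d : ℕ) : PMF (Equiv.Perm (Fin (2 ^ d))) :=
  (PMF.uniformOfFintype (F.Key sec d)).map (F.perm sec d)

/-- A permutation of `{0,1}^d` as the oracle of a circuit. -/
def permOracle {d : ℕ} (π : Equiv.Perm (Fin (2 ^ d))) : Unit → List Bool → ℕ → Bool :=
  fun _ x bit => (π (Fin.ofBits fun i : Fin d => x.getD i false)).val.testBit bit

/-- No polynomial-size oracle circuit tells the permutation of a random key from a uniformly random
permutation of the same domain. -/
def PermFamily.IsPseudorandom (F : PermFamily) : Prop :=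
  ∀ d : ℕ → ℕ, PolyBounded d →
    ∀ C : ℕ → Circuit Empty Unit, PolyBounded (fun sec => (C sec).length) →
      Negligible fun sec =>
        |acceptProb (F.fresh sec (d sec))
            (fun π => (C sec).eval (fun i => i.elim) (permOracle π)) -
          acceptProb (PMF.uniformOfFintype (Equiv.Perm (Fin (2 ^ d sec))))
            (fun π => (C sec).eval (fun i => i.elim) (permOracle π))|

/-! ### Remote storage and access patterns -/

/-- The arrays at the server: the input array of the shuffle, its temporary array, and the hash
table of each level. -/
inductive ServerArray : Type
  | input
  | temp
  | table (l : ℕ)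

def ServerArray.code : ServerArray → ℕ
  | .input => 0
  | .temp => 1
  | .table l => l + 2

/-- One access to the remote storage: a read or a write of one cell of one array. -/
structure Access where
  isWrite : Bool
  array : ServerArray
  index : ℕ

def rd (A : ServerArray) (i : ℕ) : Access := ⟨false, A, i⟩

def wr (A : ServerArray) (i : ℕ) : Access := ⟨true, A, i⟩

/-- Names of the bits of a trace; `present e` tells whether the trace has an entry number `e`. -/
inductive TraceBit : Type
  | present (e : ℕ)
  | isWrite (e : ℕ)
  | array (e b : ℕ)
  | index (e b : ℕ)

def traceBits (tr : List Access) : TraceBit → Bool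
  | .present e => decide (e < tr.length)
  | .isWrite e => (tr[e]?.map Access.isWrite).getD false
  | .array e b => (tr[e]?.map fun a => a.array.code.testBit b).getD false
  | .index e b => (tr[e]?.map fun a => a.index.testBit b).getD false

/-- A transcript lists the traces of the successive interactions with the server. -/
abbrev Transcript : Type := List (List Access)

/-- Bits of a transcript: `(p, none)` tells whether there is an interaction number `p`, and
`(p, some i)` is the bit `i` of its trace. -/
def transcriptBits (T : Transcript) : ℕ × Option TraceBit → Bool
  | (p, none) => decide (p < T.length)
  | (p, some i) => traceBits (T.getD p []) i

/-! ### Requests and oblivious RAM -/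

/-- Logical addresses of a database of `2 ^ L` blocks. -/
abbrev Addr (L : ℕ) : Type := Fin (2 ^ L)

/-- Contents of a block of `B` bits. -/
abbrev Data (B : ℕ) : Type := Fin B → Bool

inductive Request (L B : ℕ) : Type
  | read (a : Addr L)
  | write (a : Addr L) (data : Data B)

def Request.addr {L B : ℕ} : Request L B → Addr L
  | .read a => a
  | .write a _ => a

/-- A construction with (randomized) access pattern `A sec y` on the request sequence `y` is
oblivious if, for all sequences of requests of the same polynomially bounded length, the access
patterns are computationally indistinguishable. -/
def IsObliviousRAM {L B : ℕ → ℕ}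
    (A : ∀ sec, List (Request (L sec) (B sec)) → PMF Transcript) : Prop :=
  ∀ y z : ∀ sec, List (Request (L sec) (B sec)),
    (∀ sec, (y sec).length = (z sec).length) → PolyBounded (fun sec => (y sec).length) →
      Indistinguishable transcriptBits (fun sec => A sec (y sec)) (fun sec => A sec (z sec))

/-! ### Oblivious shuffles -/

/-- Input of a shuffle: an array of key-value pairs, `none` being a dummy. -/
abbrev ShuffleInput (l B : ℕ) : Type := List (Option (Fin (2 ^ (l + 1)) × Data B))

/-- The input fits into the output array, and its keys are distinct. -/
def ShuffleInput.Valid {l B : ℕ} (I : ShuffleInput l B) : Prop :=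
  I.length ≤ 2 ^ (l + 1) ∧ (I.filterMap fun c => c.map Prod.fst).Nodup

/-- A shuffle algorithm for the tables of length `2 ^ (l + 1)`. On an input array, stored at the
server, and a permutation `π`, it returns its trace and an output array, meant to hold at index
`π k` the value with key `k`, and dummies (`none`) elsewhere. -/
structure ShuffleAlg where
  run : ∀ (_sec l B : ℕ), ShuffleInput l B → Equiv.Perm (Fin (2 ^ (l + 1))) →
    PMF (List Access × (ℕ → Option (Data B)))

/-- The traces on any two inputs of the same length (and of polynomially bounded size) are
computationally indistinguishable. -/
def ShuffleAlg.IsOblivious (S : ShuffleAlg) : Prop :=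
  ∀ (l B : ℕ → ℕ), PolyBounded (fun sec => 2 ^ l sec) →
    ∀ (I J : ∀ sec, ShuffleInput (l sec) (B sec))
      (π ρ : ∀ sec, Equiv.Perm (Fin (2 ^ (l sec + 1)))),
      (∀ sec, (I sec).Valid) → (∀ sec, (J sec).Valid) →
      (∀ sec, (I sec).length = (J sec).length) →
        Indistinguishable traceBits
          (fun sec => (S.run sec (l sec) (B sec) (I sec) (π sec)).map Prod.fst)
          (fun sec => (S.run sec (l sec) (B sec) (J sec) (ρ sec)).map Prod.fst)

/-! ### The short queue shuffle

The output array has length `2 ^ (l + 1)`. There are `2 ^ (l / 2)` buckets and as many queues; the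
temporary array and the output array are divided into as many chunks. -/

namespace ShortQueue

/-- Number of buckets, of queues, of chunks and of rounds. -/
def numBuckets (l : ℕ) : ℕ := 2 ^ (l / 2)

/-- Length of a chunk. -/
def chunk (l : ℕ) : ℕ := 2 ^ (l + 1) / numBuckets l

/-- Number of cells of each chunk that are filled in each round (two if `l` is even). -/
def perRound (l : ℕ) : ℕ := chunk l / numBuckets l

/-- Private state of the client, contents of the temporary array, and the trace so far. -/
structure St (l B : ℕ) where
  queue : ℕ → List (Fin (2 ^ (l + 1)) × Data B)
  temp : ℕ → Option (Fin (2 ^ (l + 1)) × Data B)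
  trace : List Access

/-- Download cell `i` of the input; a real block joins the queue of its destination chunk. -/
def download {l B : ℕ} (I : ShuffleInput l B) (π : Equiv.Perm (Fin (2 ^ (l + 1))))
    (s : St l B) (i : ℕ) : St l B :=
  let s' : St l B := { s with trace := s.trace ++ [rd .input i] }
  match I.getD i none with
  | none => s'
  | some c =>
      let d := (π c.1).val / chunk l
      { s' with queue := Function.update s'.queue d (s'.queue d ++ [c]) }

/-- Upload the head of queue `k` (a dummy if it is empty) to cell `p` of the temporary array. -/
def upload {l B : ℕ} (k : ℕ) (s : St l B) (p : ℕ) : St l B :=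
  { queue := Function.update s.queue k (s.queue k).tail
    temp := Function.update s.temp p (s.queue k).head?
    trace := s.trace ++ [wr .temp p] }

/-- Round `j`: download the bucket, then place `perRound l` cells in every chunk. -/
def round {l B : ℕ} (I : ShuffleInput l B) (π : Equiv.Perm (Fin (2 ^ (l + 1))))
    (bucket : List ℕ) (s : St l B) (j : ℕ) : St l B :=
  (List.range (numBuckets l)).foldl
    (fun s k => ((List.range (perRound l)).map fun e => k * chunk l + j * perRound l + e).foldl
      (upload k) s)
    (bucket.foldl (download I π) s)

/-- The accesses that download every chunk of the temporary array and upload the arranged chunk to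
the output array. -/
def finalTrace (l : ℕ) : List Access :=
  (List.range (numBuckets l)).flatMap fun k =>
    ((List.range (chunk l)).map fun e => rd .temp (k * chunk l + e)) ++
      ((List.range (chunk l)).map fun e => wr (.table l) (k * chunk l + e))

/-- The arranged output: cell `p` receives, from its chunk of the temporary array and the rest of
the queue of that chunk, the block with destination `p`, or a dummy if there is none. -/
def output {l B : ℕ} (π : Equiv.Perm (Fin (2 ^ (l + 1)))) (s : St l B) (p : ℕ) :
    Option (Data B) :=
  let k := p / chunk l
  let blocks := (List.range (chunk l)).filterMap (fun e => s.temp (k * chunk l + e)) ++ s.queue k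
  (blocks.find? fun c => (π c.1).val == p).map Prod.snd

/-- The execution when the input indices are assigned to the buckets according to the order `σ`:
bucket `j` takes the `j`-th segment of `⌈|I| / numBuckets l⌉` indices. -/
def exec {l B : ℕ} (I : ShuffleInput l B) (π : Equiv.Perm (Fin (2 ^ (l + 1))))
    (σ : Equiv.Perm (Fin I.length)) : List Access × (ℕ → Option (Data B)) :=
  let size := (I.length + numBuckets l - 1) / numBuckets l
  let order : List ℕ := (List.finRange I.length).map fun i => (σ i).val
  let s := (List.range (numBuckets l)).foldl
    (fun s j => round I π ((order.drop (j * size)).take size) s j)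
    { queue := fun _ => [], temp := fun _ => none, trace := [] }
  (s.trace ++ finalTrace l, output π s)

end ShortQueue

/-- The short queue shuffle: the assignment of the input indices to the buckets is uniformly
random. -/
noncomputable def shortQueueShuffle : ShuffleAlg where
  run _ _ _ I π :=
    (PMF.uniformOfFintype (Equiv.Perm (Fin I.length))).map fun σ => ShortQueue.exec I π σ

/-! ### RankORAM -/

namespace RankORAM

/-- `rank Φ x` is the number of elements of `Φ` below `x`. -/
def rank {L : ℕ} (Φ : Finset (Addr L)) (x : Addr L) : ℕ := (Φ.filter (· < x)).card

/-- `index Φ r` is the element of `Φ` of rank `r`, and `none` if `r ≥ |Φ|`. -/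
def index {L : ℕ} (Φ : Finset (Addr L)) (r : ℕ) : Option (Addr L) := Φ.sort[r]?

/-- State of client and server. Table `l`, for `l ≤ L`, has length `2 * 2 ^ l`. Its contents are
kept without encryption because access patterns record locations only; the addresses of its blocks
are known from `Φ l` and `perm l`, and `none` is a dummy. -/
structure State (L B : ℕ) where
  occupied : Finset ℕ
  Φ : ℕ → Finset (Addr L)
  dummyCntr : ℕ → ℕ
  perm : ∀ l : ℕ, Equiv.Perm (Fin (2 ^ (l + 1)))
  table : ℕ → ℕ → Option (Data B)

variable {L B : ℕ}

/-- The smallest level whose dictionary contains `x`; it is `L` if no smaller one does. -/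
def State.level (s : State L B) (x : Addr L) : ℕ :=
  ((List.range L).find? fun i => decide (x ∈ s.Φ i)).getD L

/-- The rank of `x` in the dictionary of level `l < L`, and `x` itself at level `L`. -/
def slot (l : ℕ) (Φ : Finset (Addr L)) (x : Addr L) : ℕ :=
  if l < L then rank Φ x else x.val

def State.position (s : State L B) (x : Addr L) : ℕ :=
  slot (s.level x) (s.Φ (s.level x)) x

/-- `π_l(r)`, the table index of position `r < 2 ^ (l + 1)` of level `l`. -/
def State.permuted (s : State L B) (l r : ℕ) : ℕ :=
  (s.perm l (Fin.ofNat (2 ^ (l + 1)) r)).val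

/-- The batched query for `a`: in the level of `a` its own index, and in every other occupied level
the index of the next dummy. -/
def State.query (s : State L B) (a : Addr L) : List (ℕ × ℕ) :=
  s.occupied.sort.map fun i =>
    (i, if i = s.level a then s.permuted i (s.position a) else s.permuted i (s.dummyCntr i))

/-- The dummy counters of the levels that received a dummy probe are incremented. -/
def State.afterQuery (s : State L B) (a : Addr L) : State L B :=
  { s with dummyCntr := fun i =>
      if i ∈ s.occupied ∧ i ≠ s.level a then s.dummyCntr i + 1 else s.dummyCntr i }

/-- The contents of `a`, retrieved from the answer to the query. -/
def State.lookup (s : State L B) (a : Addr L) : Data B :=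
  (s.table (s.level a) (s.permuted (s.level a) (s.position a))).getD fun _ => false

/-- Eviction of level `j`, by increasing index, when `a` is the block just accessed: the indices of
the untouched cells, with the real block (address and contents) in each, or `none` for a dummy. A
real block is touched if it is `a` or belongs to a lower level; a dummy is touched if its position
is below the dummy counter. -/
def State.evict (s : State L B) (a : Addr L) (j : ℕ) :
    List (ℕ × Option (Addr L × Data B)) :=
  (List.finRange (2 ^ (j + 1))).filterMap fun i =>
    let r := ((s.perm j).symm i).val
    match index (s.Φ j) r with
    | some b =>
        if s.level b = j ∧ b ≠ a then
          some (i.val, some (b, (s.table j i.val).getD fun _ => false))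
        else none
    | none => if s.dummyCntr j ≤ r then some (i.val, none) else none

/-- The level to rebuild: the smallest empty one, and `L` if all levels below `L` are occupied. -/
def State.target (s : State L B) : ℕ :=
  ((List.range L).find? fun i => decide (i ∉ s.occupied)).getD L

/-- The levels that are merged by a rebuild into level `l`. -/
def State.sources (s : State L B) (l : ℕ) : List ℕ :=
  (s.occupied.filter (· ≤ l)).sort

/-- All evicted cells of a rebuild into level `l`, as (level, index, contents). -/
def State.evictAll (s : State L B) (a : Addr L) (l : ℕ) :
    List (ℕ × ℕ × Option (Addr L × Data B)) :=
  (s.sources l).flatMap fun j => (s.evict a j).map fun c => (j, c)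

/-- The accesses that build the input array: the accessed block is uploaded, then every untouched
cell is moved from its table to the end of the array. -/
def State.evictTrace (s : State L B) (a : Addr L) (l : ℕ) : List Access :=
  wr .input 0 :: ((s.evictAll a l).zipIdx 1).flatMap fun c =>
    [rd (.table c.1.1) c.1.2.1, wr .input c.2]

/-- The dictionary of level `l` after the rebuild. -/
def State.mergedDict (s : State L B) (a : Addr L) (l : ℕ) : Finset (Addr L) :=
  insert a ((Finset.range (l + 1)).biUnion s.Φ)

/-- The input array of the shuffle; the key of a block is its position in the rebuilt level. -/
def State.shuffleInput (s : State L B) (a : Addr L) (data : Data B) (l : ℕ) : ShuffleInput l B :=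
  (some (a, data) :: (s.evictAll a l).map fun c => c.2.2).map fun c =>
    c.map fun b => (Fin.ofNat (2 ^ (l + 1)) (slot l (s.mergedDict a l) b.1), b.2)

/-- The state after a rebuild into level `l`, with the new permutation `π` and the new table
`out`. -/
def State.afterRebuild (s : State L B) (a : Addr L) (l : ℕ)
    (π : Equiv.Perm (Fin (2 ^ (l + 1)))) (out : ℕ → Option (Data B)) : State L B where
  occupied := insert l (s.occupied.filter (l < ·))
  Φ := fun i => if i < l then ∅ else if i = l then s.mergedDict a l else s.Φ i
  dummyCntr := Function.update s.dummyCntr l (s.mergedDict a l).card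
  perm := Function.update s.perm l π
  table := Function.update s.table l out

/-- At the start all blocks are in level `L`, permuted by `π`. -/
def init (π : Equiv.Perm (Fin (2 ^ (L + 1)))) (db : Addr L → Data B) : State L B where
  occupied := {L}
  Φ := fun i => if i = L then Finset.univ else ∅
  dummyCntr := fun i => if i = L then 2 ^ L else 0
  perm := Function.update (fun _ => Equiv.refl _) L π
  table := fun i p => if h : i = L ∧ p < 2 ^ (L + 1) then
    (if h' : (π.symm ⟨p, h.2⟩).val < 2 ^ L then some (db ⟨_, h'⟩) else none) else none

/-- One request: batched query, then rebuild with a fresh pseudorandom permutation. The result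
consists of the three traces (query, eviction, shuffle), the answer, and the new state. -/
noncomputable def access (F : PermFamily) (S : ShuffleAlg) (sec : ℕ) (q : Request L B)
    (s : State L B) : PMF (Transcript × Data B × State L B) :=
  let a := q.addr
  let data : Data B := match q with
    | .read _ => s.lookup a
    | .write _ data' => data'
  let s' := s.afterQuery a
  let l := s'.target
  (F.fresh sec (l + 1)).bind fun π =>
    (S.run sec l B (s'.shuffleInput a data l) π).map fun o =>
      ([(s.query a).map (fun c => rd (.table c.1) c.2), s'.evictTrace a l, o.1],
        data, s'.afterRebuild a l π o.2)

/-- The transcript of a sequence of requests, from a given state. -/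
noncomputable def transcript (F : PermFamily) (S : ShuffleAlg) (sec : ℕ) :
    List (Request L B) → State L B → PMF Transcript
  | [], _ => PMF.pure []
  | q :: qs, s => (access F S sec q s).bind fun r =>
      (transcript F S sec qs r.2.2).map fun T => r.1 ++ T

/-- The access pattern of RankORAM, with permutations from `F` and shuffle `S`, on a sequence of
requests, for the initial database `db`. -/
noncomputable def accessPattern (F : PermFamily) (S : ShuffleAlg) (sec : ℕ) (db : Addr L → Data B)
    (y : List (Request L B)) : PMF Transcript :=
  (F.fresh sec (L + 1)).bind fun π => transcript F S sec y (init π db)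

end RankORAM

/-!
The access pattern of RankORAM is compared with that of an ideal world (`idealTranscript`), in which
every permutation is uniformly random and the trace of every shuffle is that of the same algorithm
on an array of dummies of the same length.

*The ideal world hides the requests perfectly* (`idealTranscript_congr`, `idealPattern_congr`). Call
a position of level `j` touched if it has been probed since the level was built. The next probe of
the level is never touched (`State.WellFormed.probe_notMem_touched`), and the cells that an eviction
moves are those of the untouched positions (`State.WellFormed.kept_iff`). During the lifetime of a
level, a uniformly random permutation `π` is therefore observed only through its values on a list of
distinct positions, whose length depends on the number of requests alone. For two request sequences
of the same length, some permutation `e` of the positions carries one list to the other, and the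
coupling of `π` with `π * e` makes the transcripts equal. Because `e` may depend on all future
requests, no conditional distributions are needed. The invariant `State.WellFormed` says that the
occupied levels count the requests in binary; it keeps the probed positions inside the tables, and
the inputs of the shuffle valid.

*The real world is indistinguishable from the ideal world*
(`abs_transcript_sub_idealTranscript_le`). By induction on the requests, one request at a time moves
to the ideal world, while all later requests are already there. There the future does not depend on
the output of the shuffle, so that for fixed values of all other random choices the transcript is a
function of one trace, or of one permutation. Hardwiring these values yields a circuit against the
shuffle, or an oracle circuit against the permutations. The latter has polynomial size because a
table has polynomially many cells: the trace of an eviction lists the cells that pass a test on the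
permutation, and its entries are computed by dynamic programming (`Computes.filter_getElem?`).
Non-uniformity turns the two assumptions into negligible bounds that hold for all sizes and inputs
at once (`exists_negligible_bound`), so that the losses of the hybrid steps can be added up.

*The short queue shuffle* is oblivious because its trace is a function of the order in which it
downloads its input, and this order is uniformly distributed for every input
(`shortQueueShuffle_isOblivious`).
-/

/-! ### Polynomial bounds and negligible functions -/

theorem PolyBounded.mono {s t : ℕ → ℕ} (h : PolyBounded t) (hst : ∀ n, s n ≤ t n) :
    PolyBounded s := by
  obtain ⟨p, hp⟩ := h
  exact ⟨p, fun n => (hst n).trans (hp n)⟩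

theorem PolyBounded.const (c : ℕ) : PolyBounded fun _ => c :=
  ⟨Polynomial.C c, fun n => by simp⟩

theorem PolyBounded.add {s t : ℕ → ℕ} (hs : PolyBounded s) (ht : PolyBounded t) :
    PolyBounded fun n => s n + t n := by
  obtain ⟨p, hp⟩ := hs
  obtain ⟨q, hq⟩ := ht
  exact ⟨p + q, fun n => by rw [Polynomial.eval_add]; exact add_le_add (hp n) (hq n)⟩

theorem PolyBounded.mul {s t : ℕ → ℕ} (hs : PolyBounded s) (ht : PolyBounded t) :
    PolyBounded fun n => s n * t n := by
  obtain ⟨p, hp⟩ := hs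
  obtain ⟨q, hq⟩ := ht
  exact ⟨p * q, fun n => by simpa using Nat.mul_le_mul (hp n) (hq n)⟩

theorem Negligible.mono {ε δ : ℕ → ℝ} (hδ : Negligible δ) (h0 : ∀ n, 0 ≤ ε n)
    (h : ∀ n, ε n ≤ δ n) : Negligible ε :=
  Asymptotics.SuperpolynomialDecay.trans_abs_le hδ fun n => by
    simpa [abs_of_nonneg (h0 n), abs_of_nonneg ((h0 n).trans (h n))] using h n

theorem Negligible.add {ε δ : ℕ → ℝ} (hε : Negligible ε) (hδ : Negligible δ) :
    Negligible fun n => ε n + δ n :=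
  Asymptotics.SuperpolynomialDecay.add hε hδ

theorem PolyBounded.mul_negligible {s : ℕ → ℕ} {ε : ℕ → ℝ} (hs : PolyBounded s)
    (h0 : ∀ n, 0 ≤ ε n) (hε : Negligible ε) : Negligible fun n => (s n : ℝ) * ε n := by
  obtain ⟨p, hp⟩ := hs
  refine Negligible.mono
    (Asymptotics.SuperpolynomialDecay.polynomial_mul hε (p.map (Nat.castRingHom ℝ)))
    (fun n => mul_nonneg (Nat.cast_nonneg _) (h0 n)) fun n => ?_
  refine mul_le_mul_of_nonneg_right ?_ (h0 n)
  have h : ((p.eval n : ℕ) : ℝ) = (p.map (Nat.castRingHom ℝ)).eval (n : ℝ) := by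
    simp
  rw [← h]
  exact_mod_cast hp n

/-- Non-uniformity: if the advantage is negligible for every choice of one parameter for each
security parameter, then it has a negligible bound that is uniform in the parameter, because some
choice reaches at least half of the supremum. -/
theorem exists_negligible_bound {ι : ℕ → Type} [hι : ∀ n, Nonempty (ι n)] (adv : ∀ n, ι n → ℝ)
    (h0 : ∀ n i, 0 ≤ adv n i) (h1 : ∀ n i, adv n i ≤ 1)
    (h : ∀ c : ∀ n, ι n, Negligible fun n => adv n (c n)) :
    ∃ ε : ℕ → ℝ, Negligible ε ∧ (∀ n, 0 ≤ ε n) ∧ ∀ n i, adv n i ≤ ε n := by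
  have hb : ∀ n, BddAbove (Set.range (adv n)) := fun n => ⟨1, by rintro _ ⟨i, rfl⟩; exact h1 n i⟩
  have hle : ∀ n i, adv n i ≤ ⨆ i, adv n i := fun n i => le_ciSup (hb n) i
  have hpos : ∀ n, 0 ≤ ⨆ i, adv n i := fun n => Real.iSup_nonneg (h0 n)
  have hc : ∀ n, ∃ i, (⨆ i, adv n i) ≤ adv n i + adv n i := fun n => by
    rcases (hpos n).eq_or_lt with hz | hz
    · obtain ⟨i⟩ := hι n
      exact ⟨i, by linarith [h0 n i]⟩
    · obtain ⟨i, hi⟩ := exists_lt_of_lt_ciSup (half_lt_self hz)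
      exact ⟨i, by linarith⟩
  choose c hc using hc
  exact ⟨_, ((h c).add (h c)).mono hpos hc, hpos, hle⟩

/-! ### Acceptance probabilities -/

section AcceptProb

variable {α β : Type}

theorem acceptProb_nonneg (p : PMF α) (f : α → Bool) : 0 ≤ acceptProb p f :=
  ENNReal.toReal_nonneg

theorem acceptProb_le_one (p : PMF α) (f : α → Bool) : acceptProb p f ≤ 1 := by
  simpa [acceptProb] using ENNReal.toReal_mono ENNReal.one_ne_top ((p.map f).coe_le_one true)

theorem abs_acceptProb_sub_le_one (p : PMF α) (q : PMF β) (f : α → Bool) (g : β → Bool) :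
    |acceptProb p f - acceptProb q g| ≤ 1 := by
  rw [abs_le]
  constructor <;> linarith [acceptProb_nonneg p f, acceptProb_le_one p f, acceptProb_nonneg q g,
    acceptProb_le_one q g]

theorem acceptProb_map (p : PMF α) (g : α → β) (f : β → Bool) :
    acceptProb (p.map g) f = acceptProb p fun a => f (g a) := by
  simp only [acceptProb, PMF.map_comp]
  rfl

theorem acceptProb_bind (p : PMF α) (k : α → PMF β) (f : β → Bool) :
    acceptProb (p.bind k) f = ∑' a, (p a).toReal * acceptProb (k a) f := by
  simp only [acceptProb, PMF.map_bind, PMF.bind_apply]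
  rw [ENNReal.tsum_toReal_eq]
  · simp
  · exact fun a => ENNReal.mul_ne_top (p.apply_ne_top a) (PMF.apply_ne_top _ _)

theorem abs_acceptProb_bind_sub_le (p : PMF α) (k k' : α → PMF β) (f : β → Bool) (ε : ℝ)
    (h : ∀ a ∈ p.support, |acceptProb (k a) f - acceptProb (k' a) f| ≤ ε) :
    |acceptProb (p.bind k) f - acceptProb (p.bind k') f| ≤ ε := by
  have hp : HasSum (fun a => (p a).toReal) 1 := by
    have h := ENNReal.hasSum_toReal (f := fun a => p a) (by simp [p.tsum_coe])
    rwa [← ENNReal.tsum_toReal_eq fun a => p.apply_ne_top a, p.tsum_coe, ENNReal.toReal_one] at h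
  have hs : ∀ k : α → PMF β, Summable fun a => (p a).toReal * acceptProb (k a) f := fun k =>
    Summable.of_nonneg_of_le
      (fun a => mul_nonneg ENNReal.toReal_nonneg (acceptProb_nonneg _ _))
      (fun a => mul_le_of_le_one_right ENNReal.toReal_nonneg (acceptProb_le_one _ _)) hp.summable
  have hterm : ∀ a, |(p a).toReal * acceptProb (k a) f - (p a).toReal * acceptProb (k' a) f| ≤
      (p a).toReal * ε := fun a => by
    rw [← mul_sub, abs_mul, abs_of_nonneg ENNReal.toReal_nonneg]
    by_cases ha : p a = 0
    · simp [ha]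
    · exact mul_le_mul_of_nonneg_left (h a ((p.mem_support_iff a).2 ha)) ENNReal.toReal_nonneg
  rw [acceptProb_bind, acceptProb_bind, ← (hs k).tsum_sub (hs k')]
  have hε := hp.mul_right ε
  rw [one_mul] at hε
  have hd := ((hs k).sub (hs k')).hasSum
  rw [abs_le]
  constructor
  · exact hasSum_le (fun a => (abs_le.1 (hterm a)).1) hε.neg hd
  · exact hasSum_le (fun a => (abs_le.1 (hterm a)).2) hd hε

end AcceptProb

/-! ### Straight-line complexity of Boolean functions -/

/-- Straight-line programs over the atomic functions in `base`, given semantically as the list of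
the functions computed so far, the latest one first. -/
inductive StraightLine {Ω : Type} (base : Set (Ω → Bool)) : List (Ω → Bool) → Prop
  | nil : StraightLine base []
  | const (b : Bool) {fs} : StraightLine base fs → StraightLine base ((fun _ => b) :: fs)
  | atom {f fs} : f ∈ base → StraightLine base fs → StraightLine base (f :: fs)
  | nand {f g fs} : f ∈ fs → g ∈ fs → StraightLine base fs →
      StraightLine base ((fun ω => !(f ω && g ω)) :: fs)

/-- All functions of `T` are computed by one straight-line program of length at most `m`. -/
def Computes {Ω : Type} (base : Set (Ω → Bool)) (T : Set (Ω → Bool)) (m : ℕ) : Prop :=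
  ∃ fs, StraightLine base fs ∧ fs.length ≤ m ∧ ∀ f ∈ T, f ∈ fs

section Computes

variable {Ω : Type} {base : Set (Ω → Bool)} {T U : Set (Ω → Bool)} {f g h : Ω → Bool} {m n : ℕ}

/-- Programs are run one after the other; functions computed twice do no harm. -/
theorem StraightLine.append {fs gs : List (Ω → Bool)} (hf : StraightLine base fs)
    (hg : StraightLine base gs) : StraightLine base (fs ++ gs) := by
  induction hf with
  | nil => exact hg
  | const b _ ih => exact .const b ih
  | atom hb _ ih => exact .atom hb ih
  | nand h1 h2 _ ih =>
    exact .nand (List.mem_append_left _ h1) (List.mem_append_left _ h2) ih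

theorem Computes.mono (hT : Computes base T m) (hU : U ⊆ T) (hmn : m ≤ n) :
    Computes base U n := by
  obtain ⟨fs, h1, h2, h3⟩ := hT
  exact ⟨fs, h1, h2.trans hmn, fun f hf => h3 f (hU hf)⟩

theorem Computes.union (hT : Computes base T m) (hU : Computes base U n) :
    Computes base (T ∪ U) (m + n) := by
  obtain ⟨fs, h1, h2, h3⟩ := hT
  obtain ⟨gs, k1, k2, k3⟩ := hU
  refine ⟨fs ++ gs, h1.append k1, by simpa using add_le_add h2 k2, fun f hf => ?_⟩
  rcases hf with hf | hf
  · exact List.mem_append_left _ (h3 f hf)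
  · exact List.mem_append_right _ (k3 f hf)

theorem Computes.const (b : Bool) : Computes base {fun _ => b} 1 :=
  ⟨[fun _ => b], .const b .nil, le_rfl, by simp⟩

theorem Computes.atom (hf : f ∈ base) : Computes base {f} 1 :=
  ⟨[f], .atom hf .nil, le_rfl, by simp⟩

theorem Computes.insert_nand (hT : Computes base T m) (hf : f ∈ T) (hg : g ∈ T) :
    Computes base (insert (fun ω => !(f ω && g ω)) T) (m + 1) := by
  obtain ⟨fs, h1, h2, h3⟩ := hT
  refine ⟨_, .nand (h3 f hf) (h3 g hg) h1, by simpa using h2, ?_⟩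
  rintro k (rfl | hk)
  · exact List.mem_cons_self
  · exact List.mem_cons_of_mem _ (h3 k hk)

theorem Computes.insert_not (hT : Computes base T m) (hf : f ∈ T) :
    Computes base (insert (fun ω => !(f ω)) T) (m + 1) := by
  simpa using hT.insert_nand hf hf

theorem Computes.insert_or (hT : Computes base T m) (hf : f ∈ T) (hg : g ∈ T) :
    Computes base (insert (fun ω => f ω || g ω) T) (m + 3) := by
  have h := ((hT.insert_not hf).insert_not (Set.mem_insert_of_mem _ hg)).insert_nand
    (Set.mem_insert_of_mem _ (Set.mem_insert _ _)) (Set.mem_insert _ _)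
  refine (h.mono ?_ le_rfl)
  rintro k (rfl | hk)
  · exact Or.inl (by funext ω; simp)
  · exact Or.inr (Or.inr (Or.inr hk))

theorem Computes.insert_cond (hT : Computes base T m) (hf : f ∈ T) (hg : g ∈ T) (hh : h ∈ T) :
    Computes base (insert (fun ω => bif f ω then g ω else h ω) T) (m + 4) := by
  have h1 := (hT.insert_nand hf hg).insert_not (Set.mem_insert_of_mem _ hf)
  have h2 := h1.insert_nand (Set.mem_insert _ _)
    (Set.mem_insert_of_mem _ (Set.mem_insert_of_mem _ hh))
  have h3 := h2.insert_nand (Set.mem_insert _ _)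
    (Set.mem_insert_of_mem _ (Set.mem_insert_of_mem _ (Set.mem_insert _ _)))
  refine h3.mono ?_ le_rfl
  rintro k (rfl | hk)
  · refine Or.inl ?_
    funext ω
    cases f ω <;> simp
  · exact Or.inr (Or.inr (Or.inr (Or.inr hk)))

theorem Computes.not (hf : Computes base {f} m) : Computes base {fun ω => !(f ω)} (m + 1) :=
  (hf.insert_not rfl).mono (by simp) le_rfl

theorem Computes.any {ι : Type} (l : List ι) (k : ι → Ω → Bool)
    (hk : ∀ i ∈ l, Computes base {k i} m) :
    Computes base {fun ω => l.any fun i => k i ω} (l.length * (m + 3) + 1) := by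
  induction l with
  | nil => simpa using Computes.const false
  | cons i l ih =>
    have h := ((hk i (by simp)).union (ih fun j hj => hk j (by simp [hj]))).insert_or
      (Or.inl rfl) (Or.inr rfl)
    refine h.mono (by simp) ?_
    simp only [List.length_cons]
    linarith

/-- A family of functions that come one after the other, each from a set `T` of functions computed
before by a bounded number of further steps. -/
theorem Computes.extend_family {ι : Type} (l : List ι) (k : ι → Ω → Bool) (c : ℕ)
    (hT : Computes base T m)
    (hk : ∀ i ∈ l, ∀ U n, T ⊆ U → Computes base U n → Computes base (insert (k i) U) (n + c)) :
    Computes base (T ∪ {f | ∃ i ∈ l, f = k i}) (m + l.length * c) := by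
  induction l with
  | nil => simpa using hT
  | cons i l ih =>
    have h := hk i (by simp) _ _ Set.subset_union_left (ih fun j hj => hk j (by simp [hj]))
    refine h.mono ?_ (by simp only [List.length_cons]; linarith)
    rintro f (hf | ⟨j, hj, rfl⟩)
    · exact Or.inr (Or.inl hf)
    · rcases List.mem_cons.1 hj with rfl | hj
      · exact Or.inl rfl
      · exact Or.inr (Or.inr ⟨j, hj, rfl⟩)

/-- Selecting entry `e` of a list from which elements are dropped according to computable flags
has polynomial complexity: the entry `e` of `c :: cs` is a case distinction on the flag of `c`
between entries `e - 1` and `e` of `cs`. -/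
theorem Computes.filter_getElem? {ι : Type} (l : List ι) (flag : Ω → ι → Bool) (v : ι → Bool)
    (hk : ∀ i ∈ l, Computes base {fun ω => flag ω i} m) (e : ℕ) :
    Computes base {fun ω => (((l.filter (flag ω))[e]?).map v).getD false}
      (l.length * (m + 4 * (l.length + 1) + 2) + 2) := by
  have main : ∀ (E : ℕ) (l : List ι), (∀ i ∈ l, Computes base {fun ω => flag ω i} m) →
      Computes base {f | ∃ e ∈ List.range (E + 1), f = fun ω =>
        (((l.filter (flag ω))[e]?).map v).getD false} (l.length * (m + 4 * (E + 1) + 2) + 1) := by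
    intro E l hl
    induction l with
    | nil =>
      refine (Computes.const false).mono ?_ (by simp)
      rintro f ⟨e, -, rfl⟩
      simp
    | cons c cs ih =>
      have h0 := ((ih fun j hj => hl j (by simp [hj])).union (hl c (by simp))).union
        (Computes.const (v c))
      have h1 := h0.extend_family (List.range (E + 1))
        (fun e ω => ((((c :: cs).filter (flag ω))[e]?).map v).getD false) 4 ?_
      · refine h1.mono Set.subset_union_right ?_
        simp only [List.length_cons, List.length_range]
        linarith
      · intro e he U n hU hn
        have hflag : (fun ω => flag ω c) ∈ U := hU (Or.inl (Or.inr rfl))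
        have hcur : (fun ω => (((cs.filter (flag ω))[e]?).map v).getD false) ∈ U :=
          hU (Or.inl (Or.inl ⟨e, he, rfl⟩))
        cases e with
        | zero =>
          have hv : (fun _ => v c) ∈ U := hU (Or.inr rfl)
          convert hn.insert_cond hflag hv hcur using 3 with ω
          cases hc : flag ω c <;> simp [hc]
        | succ e =>
          have hprev : (fun ω => (((cs.filter (flag ω))[e]?).map v).getD false) ∈ U :=
            hU (Or.inl (Or.inl ⟨e, by simp only [List.mem_range] at he ⊢; omega, rfl⟩))
          convert hn.insert_cond hflag hprev hcur using 3 with ω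
          cases hc : flag ω c <;> simp [hc]
  by_cases he : e < l.length + 1
  · refine (main l.length l hk).mono ?_ (by omega)
    rintro _ rfl
    exact ⟨e, by simpa using he, rfl⟩
  · refine (Computes.const false).mono ?_ (by omega)
    rintro _ rfl
    funext ω
    rw [List.getElem?_eq_none ((List.length_filter_le _ _).trans (by omega))]
    rfl

end Computes

/-! ### Circuits and straight-line programs -/

section Circuits

variable {Ω ι κ : Type} {base : Set (Ω → Bool)}

/-- The values of all wires of a circuit, in the order of the gates. -/
def Circuit.wires (C : Circuit ι κ) (x : ι → Bool) (O : κ → List Bool → ℕ → Bool) : List Bool :=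
  C.foldl (fun w g => w ++ [g.value x O w]) []

theorem Circuit.wires_append_singleton (C : Circuit ι κ) (g : Gate ι κ) (x : ι → Bool)
    (O : κ → List Bool → ℕ → Bool) :
    Circuit.wires (C ++ [g]) x O = C.wires x O ++ [g.value x O (C.wires x O)] := by
  simp [Circuit.wires]

theorem Circuit.length_wires (C : Circuit ι κ) (x : ι → Bool) (O : κ → List Bool → ℕ → Bool) :
    (C.wires x O).length = C.length := by
  induction C using List.reverseRecOn with
  | nil => rfl
  | append_singleton C g ih => simp [Circuit.wires_append_singleton, ih]

/-- A straight-line program becomes a circuit if every atomic function is computed by one gate.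
Two additional wires with the constants `false` and `true` supply the argument of an oracle gate. -/
theorem StraightLine.exists_circuit {fs : List (Ω → Bool)} (h : StraightLine base fs)
    (x : Ω → ι → Bool) (O : Ω → κ → List Bool → ℕ → Bool)
    (hbase : ∀ f ∈ base, ∃ g : Gate ι κ, ∀ ω w, g.value (x ω) (O ω) (false :: true :: w) = f ω) :
    ∃ C : Circuit ι κ, C.length = fs.length + 2 ∧
      ∀ ω, C.wires (x ω) (O ω) = false :: true :: fs.reverse.map fun f => f ω := by
  have hget : ∀ {fs : List (Ω → Bool)} {f}, f ∈ fs → ∃ j, ∀ ω,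
      (false :: true :: fs.reverse.map fun f => f ω).getD j false = f ω := by
    intro fs f hf
    obtain ⟨j, hj, hjf⟩ := List.getElem_of_mem (List.mem_reverse.2 hf)
    refine ⟨j + 2, fun ω => ?_⟩
    simp only [List.getD_cons_succ]
    rw [List.getD_eq_getElem _ _ (by simpa using hj), List.getElem_map, hjf]
  induction h with
  | nil => exact ⟨[.const false, .const true], rfl, fun ω => rfl⟩
  | const b _ ih =>
    obtain ⟨C, hC, hw⟩ := ih
    refine ⟨C ++ [.const b], by simp [hC], fun ω => ?_⟩
    simp [Circuit.wires_append_singleton, hw, Gate.value]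
  | atom hf _ ih =>
    obtain ⟨C, hC, hw⟩ := ih
    obtain ⟨g, hg⟩ := hbase _ hf
    refine ⟨C ++ [g], by simp [hC], fun ω => ?_⟩
    simp [Circuit.wires_append_singleton, hw, hg]
  | nand h1 h2 _ ih =>
    obtain ⟨C, hC, hw⟩ := ih
    obtain ⟨j, hj⟩ := hget h1
    obtain ⟨k, hk⟩ := hget h2
    refine ⟨C ++ [.nand j k], by simp [hC], fun ω => ?_⟩
    rw [Circuit.wires_append_singleton, hw, Gate.value, hj, hk]
    simp

theorem Computes.exists_circuit {f : Ω → Bool} {m : ℕ} (hf : Computes base {f} m)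
    (x : Ω → ι → Bool) (O : Ω → κ → List Bool → ℕ → Bool)
    (hbase : ∀ f ∈ base, ∃ g : Gate ι κ, ∀ ω w, g.value (x ω) (O ω) (false :: true :: w) = f ω) :
    ∃ C : Circuit ι κ, C.length ≤ m + 4 ∧ ∀ ω, C.eval (x ω) (O ω) = f ω := by
  obtain ⟨fs, h1, h2, h3⟩ := hf
  -- A double negation copies `f` to the last wire.
  have h4 := h1.nand (h3 f rfl) (h3 f rfl)
  have h5 := h4.nand List.mem_cons_self List.mem_cons_self
  obtain ⟨C, hC, hw⟩ := h5.exists_circuit x O hbase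
  refine ⟨C, by simp only [List.length_cons] at hC; omega, fun ω => ?_⟩
  change (C.wires (x ω) (O ω)).getLastD false = f ω
  rw [hw, List.reverse_cons, List.map_append, ← List.cons_append, ← List.cons_append,
    List.map_singleton, List.getLastD_concat]
  simp

/-- A circuit applied to bits of low complexity has low complexity. -/
theorem Circuit.computes_eval (C : Circuit ι Empty) (bits : Ω → ι → Bool) (s : ℕ)
    (hbits : ∀ i, Computes base {fun ω => bits ω i} s) :
    Computes base {fun ω => C.eval (bits ω) fun o => o.elim} (C.length * (s + 1) + 1) := by
  have main : Computes base {f | ∃ j, f = fun ω =>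
      (C.wires (bits ω) fun o => o.elim).getD j false} (C.length * (s + 1) + 1) := by
    induction C using List.reverseRecOn with
    | nil =>
      refine (Computes.const false).mono ?_ (by simp)
      rintro f ⟨j, rfl⟩
      rfl
    | append_singleton C g ih =>
      have hg : Computes base (insert (fun ω => g.value (bits ω) (fun o => o.elim)
          (Circuit.wires C (bits ω) fun o => o.elim)) {f | ∃ j, f = fun ω =>
            (Circuit.wires C (bits ω) fun o => o.elim).getD j false})
          ((C ++ [g]).length * (s + 1) + 1) := by
        have hlen : (C ++ [g]).length * (s + 1) = C.length * (s + 1) + (s + 1) := by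
          rw [List.length_append, List.length_singleton, Nat.succ_mul]
        rw [hlen]
        cases g with
        | input i => exact (ih.union (hbits i)).mono (by rw [Set.union_singleton]; rfl) (by omega)
        | const b =>
          exact (ih.union (Computes.const b)).mono (by rw [Set.union_singleton]; rfl) (by omega)
        | nand j k => exact (ih.insert_nand ⟨j, rfl⟩ ⟨k, rfl⟩).mono subset_rfl (by omega)
        | query o => exact o.elim
      refine hg.mono ?_ le_rfl
      rintro f ⟨j, rfl⟩
      simp only [Circuit.wires_append_singleton]
      rcases lt_trichotomy j C.length with hj | hj | hj
      · refine Or.inr ⟨j, ?_⟩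
        funext ω
        rw [List.getD_append _ _ _ _ (by rwa [Circuit.length_wires])]
      · refine Or.inl ?_
        funext ω
        rw [List.getD_append_right _ _ _ _ (by rw [Circuit.length_wires, hj]),
          Circuit.length_wires, hj]
        simp
      · -- Beyond the last wire the value is `false`, as for the wires of `C`.
        refine Or.inr ⟨j, ?_⟩
        funext ω
        rw [List.getD_eq_default, List.getD_eq_default]
        · rw [Circuit.length_wires]
          omega
        · rw [List.length_append, Circuit.length_wires, List.length_singleton]
          omega
  refine main.mono ?_ le_rfl
  rintro _ rfl
  refine ⟨C.length - 1, ?_⟩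
  funext ω
  change (C.wires (bits ω) fun o => o.elim).getLastD false = _
  rw [List.getLastD_eq_getLast?, List.getLast?_eq_getElem?, Circuit.length_wires,
    List.getD_eq_getElem?_getD]

/-- The bits of the values of a permutation, as functions of the permutation. -/
def permAtoms (d : ℕ) : Set (Equiv.Perm (Fin (2 ^ d)) → Bool) :=
  {f | ∃ r b, f = fun π => (π r).val.testBit b}

theorem permAtoms_gate {d : ℕ} (f) (hf : f ∈ permAtoms d) :
    ∃ g : Gate Empty Unit, ∀ π w,
      g.value (fun i => i.elim) (permOracle π) (false :: true :: w) = f π := by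
  obtain ⟨r, b, rfl⟩ := hf
  refine ⟨.query () ((List.range d).map fun i => if r.val.testBit i then 1 else 0) b,
    fun π w => ?_⟩
  have hr : (Fin.ofBits fun i : Fin d => (((List.range d).map fun i =>
      if r.val.testBit i then 1 else 0).map fun j => (false :: true :: w).getD j false).getD i
        false) = r := by
    have : (fun i : Fin d => (((List.range d).map fun i =>
        if r.val.testBit i then 1 else 0).map fun j => (false :: true :: w).getD j false).getD i
          false) = fun i : Fin d => r.val.testBit i := by
      funext i
      rw [List.getD_eq_getElem _ _ (by simp)]
      cases h : r.val.testBit i <;> simp [h]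
    rw [this]
    ext
    simp [Nat.ofBits_testBit, Nat.mod_eq_of_lt r.isLt]
  simp only [Gate.value, permOracle]
  rw [hr]

/-- A test of the preimage of `i` is the disjunction, over all positions `r` that pass the test, of
`π r = i`. This is short because the domain is small. -/
theorem computes_symm_perm {d : ℕ} (p : Fin (2 ^ d) → Bool) (i : Fin (2 ^ d)) :
    Computes (permAtoms d) {fun π => p (π.symm i)} (2 ^ d * (d * 5 + 5) + 1) := by
  have hbit : ∀ (r : Fin (2 ^ d)) (b : ℕ),
      Computes (permAtoms d) {fun π => (π r).val.testBit b != i.val.testBit b} 2 := by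
    intro r b
    have h : Computes (permAtoms d) {fun π => (π r).val.testBit b} 1 := .atom ⟨r, b, rfl⟩
    cases i.val.testBit b
    · simpa using h.mono subset_rfl one_le_two
    · simpa using h.not
  have heq : ∀ r : Fin (2 ^ d), Computes (permAtoms d) {fun π => decide (π r = i)}
      (d * 5 + 2) := by
    intro r
    refine ((Computes.any (List.range d) _ fun b _ => hbit r b).not).mono ?_ (by simp)
    rintro _ rfl
    funext π
    rw [Bool.eq_iff_iff, Bool.not_eq_true', ← Bool.not_eq_true, decide_eq_true_eq]
    simp only [List.any_eq_true, List.mem_range, bne_iff_ne, not_exists, not_and, not_not, ne_eq]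
    refine ⟨fun h b _ => by rw [h], fun h => ?_⟩
    refine Fin.ext ?_
    refine Nat.eq_of_testBit_eq fun b => ?_
    by_cases hb : b < d
    · exact h b hb
    · have : 2 ^ d ≤ 2 ^ b := Nat.pow_le_pow_right two_pos (by omega)
      rw [Nat.testBit_lt_two_pow ((π r).isLt.trans_le this),
        Nat.testBit_lt_two_pow (i.isLt.trans_le this)]
  have h := Computes.any ((List.finRange (2 ^ d)).filter p) _ fun r _ => heq r
  refine h.mono ?_ ?_
  · rintro _ rfl
    funext π
    rw [← Bool.decide_coe (p _), ← Bool.decide_coe (List.any _ _), decide_eq_decide]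
    simp only [List.any_eq_true, List.mem_filter, List.mem_finRange, true_and, decide_eq_true_eq]
    constructor
    · exact fun hp => ⟨_, hp, by simp⟩
    · rintro ⟨r, hr, rfl⟩
      simpa using hr
  · have := List.length_filter_le p (List.finRange (2 ^ d))
    rw [List.length_finRange] at this
    gcongr

end Circuits

/-! ### Obliviousness of the short queue shuffle -/

namespace ShortQueue

variable {l B : ℕ}

theorem trace_foldl_download (I : ShuffleInput l B) (π : Equiv.Perm (Fin (2 ^ (l + 1))))
    (bucket : List ℕ) (s : St l B) :
    (bucket.foldl (download I π) s).trace = s.trace ++ bucket.map (rd .input) := by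
  induction bucket generalizing s with
  | nil => simp
  | cons i bucket ih =>
    have h : (download I π s i).trace = s.trace ++ [rd .input i] := by
      unfold download
      split <;> rfl
    simp [ih, h]

theorem trace_foldl_upload (k : ℕ) (cells : List ℕ) (s : St l B) :
    (cells.foldl (upload k) s).trace = s.trace ++ cells.map (wr .temp) := by
  induction cells generalizing s with
  | nil => simp
  | cons p cells ih => simp [ih, upload]

theorem trace_foldl_chunks (cells : ℕ → List ℕ) (ks : List ℕ) (s : St l B) :
    (ks.foldl (fun s k => (cells k).foldl (upload k) s) s).trace =
      s.trace ++ ks.flatMap fun k => (cells k).map (wr .temp) := by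
  induction ks generalizing s with
  | nil => simp
  | cons k ks ih => simp [ih, trace_foldl_upload]

/-- The accesses of round `j`: they depend on the indices in the bucket only. -/
def roundTrace (l : ℕ) (bucket : List ℕ) (j : ℕ) : List Access :=
  bucket.map (rd .input) ++ (List.range (numBuckets l)).flatMap fun k =>
    ((List.range (perRound l)).map fun e => k * chunk l + j * perRound l + e).map (wr .temp)

theorem trace_foldl_round (I : ShuffleInput l B) (π : Equiv.Perm (Fin (2 ^ (l + 1))))
    (bucket : ℕ → List ℕ) (js : List ℕ) (s : St l B) :
    (js.foldl (fun s j => round I π (bucket j) s j) s).trace =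
      s.trace ++ js.flatMap fun j => roundTrace l (bucket j) j := by
  induction js generalizing s with
  | nil => simp
  | cons j js ih =>
    rw [List.foldl_cons, ih, round, trace_foldl_chunks, trace_foldl_download, List.flatMap_cons,
      roundTrace, List.append_assoc, List.append_assoc, List.append_assoc]

/-- The trace of an execution on an input of length `n`, as a function of the order in which the
input is downloaded. -/
def execTrace (l n : ℕ) (σ : Equiv.Perm (Fin n)) : List Access :=
  ((List.range (numBuckets l)).flatMap fun j => roundTrace l
    ((((List.finRange n).map fun i => (σ i).val).drop
      (j * ((n + numBuckets l - 1) / numBuckets l))).take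
        ((n + numBuckets l - 1) / numBuckets l)) j) ++ finalTrace l

theorem exec_fst (I : ShuffleInput l B) (π : Equiv.Perm (Fin (2 ^ (l + 1))))
    (σ : Equiv.Perm (Fin I.length)) : (exec I π σ).1 = execTrace l I.length σ := by
  simp only [exec, execTrace, trace_foldl_round, List.nil_append]

end ShortQueue

theorem Indistinguishable.of_eq {α ι : Type} (bits : α → ι → Bool) {X Y : ℕ → PMF α}
    (h : ∀ sec, X sec = Y sec) : Indistinguishable bits X Y := by
  intro C _
  simp only [h, sub_self, abs_zero]
  exact Asymptotics.superpolynomialDecay_zero _ _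

/-- The queues hide the input perfectly: the trace is a function of the download order, which is
uniformly distributed on any input. -/
theorem shortQueueShuffle_isOblivious : shortQueueShuffle.IsOblivious := by
  intro l B _ I J π ρ _ _ hIJ
  have key : ∀ sec (I : ShuffleInput (l sec) (B sec)) π,
      (shortQueueShuffle.run sec (l sec) (B sec) I π).map Prod.fst =
        (PMF.uniformOfFintype (Equiv.Perm (Fin I.length))).map
          (ShortQueue.execTrace (l sec) I.length) := by
    intro sec I π
    simp only [shortQueueShuffle, PMF.map_comp]
    congr 1
    funext σ
    exact ShortQueue.exec_fst I π σ
  refine Indistinguishable.of_eq _ fun sec => ?_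
  rw [key, key, hIJ]

/-! ### Ranks in a dictionary -/

namespace RankORAM

variable {L B : ℕ}

theorem rank_orderEmbOfFin (Φ : Finset (Addr L)) (i : Fin Φ.card) :
    rank Φ (Φ.orderEmbOfFin rfl i) = i := by
  have h : Φ.filter (· < Φ.orderEmbOfFin rfl i) =
      (Finset.Iio i).map (Φ.orderEmbOfFin rfl).toEmbedding := by
    ext x
    simp only [Finset.mem_filter, Finset.mem_map, Finset.mem_Iio, RelEmbedding.coe_toEmbedding]
    constructor
    · rintro ⟨hx, hlt⟩
      have : x ∈ Set.range (Φ.orderEmbOfFin rfl) := by rwa [Finset.range_orderEmbOfFin]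
      obtain ⟨j, rfl⟩ := this
      exact ⟨j, by simpa using hlt, rfl⟩
    · rintro ⟨j, hj, rfl⟩
      exact ⟨Finset.orderEmbOfFin_mem _ _ _, by simpa using hj⟩
  rw [rank, h, Finset.card_map, Fin.card_Iio]

theorem index_eq_some_iff {Φ : Finset (Addr L)} {r : ℕ} {b : Addr L} :
    index Φ r = some b ↔ b ∈ Φ ∧ rank Φ b = r := by
  rw [index, List.getElem?_eq_some_iff]
  constructor
  · rintro ⟨h, rfl⟩
    have hr : r < Φ.card := by simpa using h
    have := rank_orderEmbOfFin Φ ⟨r, hr⟩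
    rw [Finset.orderEmbOfFin_apply] at this
    exact ⟨(Finset.mem_sort (· ≤ ·)).1 (List.getElem_mem h), this⟩
  · rintro ⟨hb, rfl⟩
    have : b ∈ Set.range (Φ.orderEmbOfFin rfl) := by rwa [Finset.range_orderEmbOfFin]
    obtain ⟨j, rfl⟩ := this
    simp only [rank_orderEmbOfFin]
    exact ⟨by simp, (Finset.orderEmbOfFin_apply _ _ _).symm⟩

theorem index_eq_none_iff {Φ : Finset (Addr L)} {r : ℕ} : index Φ r = none ↔ Φ.card ≤ r := by
  simp [index]

theorem rank_lt_card {Φ : Finset (Addr L)} {b : Addr L} (hb : b ∈ Φ) : rank Φ b < Φ.card := by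
  by_contra h
  have h1 := index_eq_none_iff.2 (not_lt.1 h)
  rw [index_eq_some_iff.2 ⟨hb, rfl⟩] at h1
  cases h1

theorem rank_injOn (Φ : Finset (Addr L)) : Set.InjOn (rank Φ) Φ := by
  intro b hb c hc h
  have h1 := index_eq_some_iff.2 ⟨hb, rfl⟩
  rw [h, index_eq_some_iff.2 ⟨hc, rfl⟩] at h1
  exact (Option.some.inj h1).symm

theorem slot_eq_rank {l : ℕ} {Φ : Finset (Addr L)} (h : L ≤ l → Φ = Finset.univ) (x : Addr L) :
    slot l Φ x = rank Φ x := by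
  rw [slot]
  split_ifs with hl
  · rfl
  · rw [h (not_lt.1 hl), rank]
    have : Finset.univ.filter (· < x) = Finset.Iio x := by
      ext
      simp
    rw [this, Fin.card_Iio]

/-! ### Levels, probes and touched positions -/

theorem find?_range_getD_spec (n : ℕ) (p : ℕ → Bool) :
    ((List.range n).find? p).getD n ≤ n ∧
      (((List.range n).find? p).getD n < n → p (((List.range n).find? p).getD n)) ∧
        ∀ i < ((List.range n).find? p).getD n, ¬ p i := by
  cases h : (List.range n).find? p with
  | none => simpa using h
  | some m =>
    rw [List.find?_range_eq_some] at h
    simp only [Option.getD_some]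
    exact ⟨(List.mem_range.1 h.2.1).le, fun _ => h.1, fun i hi => by simpa using h.2.2 i hi⟩

namespace State

variable (s : State L B) (a : Addr L)

theorem level_le (x : Addr L) : s.level x ≤ L :=
  (find?_range_getD_spec L fun i => decide (x ∈ s.Φ i)).1

theorem target_le : s.target ≤ L :=
  (find?_range_getD_spec L fun i => decide (i ∉ s.occupied)).1

theorem target_notMem (h : s.target < L) : s.target ∉ s.occupied := by
  exact of_decide_eq_true ((find?_range_getD_spec L fun i => decide (i ∉ s.occupied)).2.1 h)

theorem mem_of_lt_target {i : ℕ} (h : i < s.target) : i ∈ s.occupied := by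
  simpa using (find?_range_getD_spec L fun i => decide (i ∉ s.occupied)).2.2 i h

theorem level_eq_iff {x : Addr L} {j : ℕ} (hj : j ≤ L) (hx : x ∈ s.Φ j) :
    s.level x = j ↔ ∀ i < j, x ∉ s.Φ i := by
  obtain ⟨-, h1, h2⟩ := find?_range_getD_spec L fun i => decide (x ∈ s.Φ i)
  change (s.level x < L → decide (x ∈ s.Φ (s.level x)) = true) at h1
  change (∀ i < s.level x, ¬ decide (x ∈ s.Φ i) = true) at h2
  simp only [decide_eq_true_eq] at h1 h2
  constructor
  · rintro rfl
    exact h2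
  · intro h
    rcases lt_trichotomy (s.level x) j with hlt | heq | hlt
    · exact absurd (h1 (hlt.trans_le hj)) (h _ hlt)
    · exact heq
    · exact absurd hx (h2 j hlt)

/-- The position that a request for `a` probes in level `j`. -/
def probe (j : ℕ) : Fin (2 ^ (j + 1)) :=
  Fin.ofNat _ (if j = s.level a then s.position a else s.dummyCntr j)

/-- The positions of level `j` that have been probed since the level was built: those of the blocks
that now have a lower level, and those of the dummies below the counter. -/
def touched (j : ℕ) : Finset (Fin (2 ^ (j + 1))) :=
  Finset.univ.filter fun r => (match index (s.Φ j) r.val with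
    | some b => decide (s.level b ≠ j)
    | none => decide (r.val < s.dummyCntr j)) = true

/-- Whether the eviction after a request for `a` moves the cell with position `r` of level `j`. -/
def kept (j : ℕ) (r : Fin (2 ^ (j + 1))) : Bool :=
  match index (s.Φ j) r.val with
  | some b => decide (s.level b = j ∧ b ≠ a)
  | none => decide (s.dummyCntr j ≤ r.val)

theorem query_eq : s.query a = s.occupied.sort.map fun i => (i, (s.perm i (s.probe a i)).val) := by
  refine List.map_congr_left fun i _ => ?_
  rw [probe]
  split_ifs <;> rfl

theorem map_fst_evict (j : ℕ) : (s.evict a j).map Prod.fst =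
    ((List.finRange (2 ^ (j + 1))).filter fun i => s.kept a j ((s.perm j).symm i)).map
      Fin.val := by
  rw [evict, List.map_filterMap, ← List.filterMap_eq_map, List.filterMap_filter]
  congr 1
  funext i
  cases h : index (s.Φ j) ((s.perm j).symm i).val with
  | none =>
    have hk : s.kept a j ((s.perm j).symm i) =
        decide (s.dummyCntr j ≤ ((s.perm j).symm i).val) := by
      simp only [kept, h]
    rw [hk]
    dsimp only
    rw [h]
    by_cases hc : s.dummyCntr j ≤ ((s.perm j).symm i).val <;> simp [hc]
  | some b =>
    have hk : s.kept a j ((s.perm j).symm i) = decide (s.level b = j ∧ b ≠ a) := by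
      simp only [kept, h]
    rw [hk]
    dsimp only
    rw [h]
    by_cases hc : s.level b = j ∧ b ≠ a <;> simp [hc]

end State

/-- The number of requests since level `j` was built, which is the number of probes of the level:
the occupied levels below `L` are the binary digits of a request counter. -/
def age (occ : Finset ℕ) (j : ℕ) : ℕ := ∑ i ∈ occ.filter (· < j), 2 ^ i

theorem age_lt (occ : Finset ℕ) (j : ℕ) : age occ j < 2 ^ j :=
  Nat.geomSum_lt le_rfl fun _ hk => (Finset.mem_filter.1 hk).2

theorem age_of_forall_mem {occ : Finset ℕ} {j : ℕ} (h : ∀ i < j, i ∈ occ) :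
    age occ j + 1 = 2 ^ j := by
  have hf : occ.filter (· < j) = Finset.range j := by
    ext i
    simp only [Finset.mem_filter, Finset.mem_range]
    exact ⟨fun hi => hi.2, fun hi => ⟨h i hi, hi⟩⟩
  rw [age, hf, Nat.geomSum_eq le_rfl]
  have := Nat.one_le_two_pow (n := j)
  simp only [Nat.add_one_sub_one, Nat.div_one]
  omega

/-- A rebuild into level `l` increments the binary counter, as seen by a higher level. -/
theorem age_rebuild {occ : Finset ℕ} {l j : ℕ} (hlow : ∀ i < l, i ∈ occ) (hl : l ∉ occ)
    (hj : l < j) : age (insert l (occ.filter (l < ·))) j = age occ j + 1 := by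
  have h1 : (insert l (occ.filter (l < ·))).filter (· < j) =
      insert l ((occ.filter (· < j)).filter (l < ·)) := by
    ext i
    simp only [Finset.mem_filter, Finset.mem_insert]
    grind
  have h2 : (occ.filter (· < j)).filter (¬ l < ·) = occ.filter (· < l) := by
    ext i
    simp only [Finset.mem_filter]
    grind
  have h3 := Finset.sum_filter_add_sum_filter_not (occ.filter (· < j)) (l < ·) fun i => 2 ^ i
  rw [h2] at h3
  have h4 := age_of_forall_mem hlow
  rw [age, h1, Finset.sum_insert (by simp), age, ← h3]
  rw [age] at h4
  omega

/-! ### The invariant -/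

/-- The invariant of the states that RankORAM reaches. The counters stay within the tables because
a level with at most `2 ^ j` blocks is probed fewer than `2 ^ j` times before its last request. -/
structure State.WellFormed (s : State L B) : Prop where
  le_of_mem : ∀ j ∈ s.occupied, j ≤ L
  top_mem : L ∈ s.occupied
  dict_top : s.Φ L = Finset.univ
  dict_of_notMem : ∀ j ∉ s.occupied, s.Φ j = ∅
  card_dict : ∀ j, (s.Φ j).card ≤ 2 ^ j
  card_le_cntr : ∀ j ∈ s.occupied, (s.Φ j).card ≤ s.dummyCntr j
  cntr_le : ∀ j ∈ s.occupied, s.dummyCntr j ≤ (s.Φ j).card + age s.occupied j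
  card_touched : ∀ j ∈ s.occupied, (s.touched j).card = age s.occupied j

namespace State.WellFormed

variable {s : State L B} (a : Addr L)

theorem mem_level (hs : s.WellFormed) (x : Addr L) : x ∈ s.Φ (s.level x) := by
  obtain ⟨h0, h1, -⟩ := find?_range_getD_spec L fun i => decide (x ∈ s.Φ i)
  rcases (s.level_le x).lt_or_eq with h | h
  · exact of_decide_eq_true (h1 h)
  · rw [h, hs.dict_top]
    exact Finset.mem_univ x

theorem val_probe (hs : s.WellFormed) {j : ℕ} (hj : j ∈ s.occupied) : (s.probe a j).val =
    if j = s.level a then rank (s.Φ j) a else s.dummyCntr j := by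
  have hcard := hs.card_dict j
  rw [probe, Fin.val_ofNat]
  split_ifs with h
  · subst h
    have hr := rank_lt_card (hs.mem_level a)
    rw [position, slot_eq_rank fun hL => ?_, Nat.mod_eq_of_lt (by rw [pow_succ]; omega)]
    rw [le_antisymm (s.level_le a) hL, hs.dict_top]
  · have h1 := hs.cntr_le j hj
    have h2 := age_lt s.occupied j
    rw [Nat.mod_eq_of_lt (by rw [pow_succ]; omega)]

theorem probe_notMem_touched (hs : s.WellFormed) {j : ℕ} (hj : j ∈ s.occupied) :
    s.probe a j ∉ s.touched j := by
  have hp := hs.val_probe a hj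
  simp only [touched, Finset.mem_filter, Finset.mem_univ, true_and]
  rw [hp]
  split_ifs with h
  · subst h
    rw [index_eq_some_iff.2 ⟨hs.mem_level a, rfl⟩]
    simp
  · rw [index_eq_none_iff.2 (hs.card_le_cntr j hj)]
    simp

/-- The cells that stay behind in an eviction are exactly those that were probed. -/
theorem kept_iff (hs : s.WellFormed) {j : ℕ} (hj : j ∈ s.occupied) (r : Fin (2 ^ (j + 1))) :
    (s.afterQuery a).kept a j r = true ↔ r ∉ insert (s.probe a j) (s.touched j) := by
  have hp := hs.val_probe a hj
  have hlev : ∀ b, (s.afterQuery a).level b = s.level b := fun b => rfl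
  have hcard := hs.card_le_cntr j hj
  simp only [kept, touched, Finset.mem_insert, Finset.mem_filter, Finset.mem_univ, true_and,
    hlev, Fin.ext_iff, hp]
  change (match index (s.Φ j) r.val with
    | some b => decide (s.level b = j ∧ b ≠ a)
    | none => decide ((if j ∈ s.occupied ∧ j ≠ s.level a then s.dummyCntr j + 1
        else s.dummyCntr j) ≤ r.val)) = true ↔ _
  cases h : index (s.Φ j) r.val with
  | none =>
    rw [index_eq_none_iff] at h
    by_cases hja : j = s.level a
    · have hr := rank_lt_card (hs.mem_level a)
      rw [← hja] at hr
      simp only [hja, ne_eq, not_true_eq_false, and_false, if_false, if_true, decide_eq_true_eq]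
      rw [← hja]
      omega
    · simp only [hj, hja, ne_eq, not_false_eq_true, and_true, if_true, if_false,
        decide_eq_true_eq]
      omega
  | some b =>
    obtain ⟨hb, hr⟩ := index_eq_some_iff.1 h
    have hlt := rank_lt_card hb
    simp only [decide_eq_true_eq, ← hr, not_or, ne_eq, not_not]
    split_ifs with hja
    · have : rank (s.Φ j) b = rank (s.Φ j) a ↔ b = a := by
        refine ⟨fun he => rank_injOn _ hb ?_ he, fun he => he ▸ rfl⟩
        rw [hja]
        exact hs.mem_level a
      rw [this]
      tauto
    · constructor
      · exact fun h1 => ⟨by omega, h1.1⟩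
      · refine fun h1 => ⟨h1.2, ?_⟩
        rintro rfl
        exact hja h1.2.symm

variable (π : Equiv.Perm (Fin (2 ^ (s.target + 1)))) (out : ℕ → Option (Data B))

theorem target_lt_of_mem (hs : s.WellFormed) {j : ℕ} (hj : j ∈ s.occupied) (h : s.target < j) :
    s.target ∉ s.occupied :=
  s.target_notMem (h.trans_le (hs.le_of_mem j hj))

/-- A level above the rebuilt one remembers the probe of the request as touched. -/
theorem touched_next (hs : s.WellFormed) {j : ℕ} (hj : j ∈ s.occupied) (hlt : s.target < j) :
    ((s.afterQuery a).afterRebuild a s.target π out).touched j =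
      insert (s.probe a j) (s.touched j) := by
  ext r
  rw [← not_iff_not, ← hs.kept_iff a hj r]
  have hΦ : ((s.afterQuery a).afterRebuild a s.target π out).Φ j = s.Φ j := by
    simp [afterRebuild, hlt.ne', hlt.not_gt, afterQuery]
  have hc : ((s.afterQuery a).afterRebuild a s.target π out).dummyCntr j =
      (s.afterQuery a).dummyCntr j := by
    simp [afterRebuild, hlt.ne']
  have hΦ' : (s.afterQuery a).Φ = s.Φ := rfl
  simp only [touched, Finset.mem_filter, Finset.mem_univ, true_and, hΦ, kept, hc, hΦ']
  cases h : index (s.Φ j) r.val with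
  | none => simp
  | some b =>
    obtain ⟨hb, -⟩ := index_eq_some_iff.1 h
    have hjL := hs.le_of_mem j hj
    simp only [ne_eq, decide_eq_true_eq, not_not]
    rw [level_eq_iff _ hjL (by rwa [hΦ]), show (s.afterQuery a).level b = s.level b from rfl,
      level_eq_iff _ hjL hb]
    simp only [afterRebuild, mergedDict, hΦ']
    constructor
    · intro h1
      refine ⟨fun i hi hbi => ?_, ?_⟩
      · rcases lt_or_ge s.target i with hti | hti
        · exact h1 i hi (by simpa [hti.ne', hti.not_gt] using hbi)
        · refine h1 _ hlt ?_
          simp only [lt_self_iff_false, if_false, if_true, Finset.mem_insert, Finset.mem_biUnion,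
            Finset.mem_range]
          exact Or.inr ⟨i, by omega, hbi⟩
      · rintro rfl
        exact h1 _ hlt (by simp)
    · rintro ⟨h1, h2⟩ i hi hbi
      split_ifs at hbi with h3 h4
      · simp at hbi
      · simp only [Finset.mem_insert, Finset.mem_biUnion, Finset.mem_range] at hbi
        obtain rfl | ⟨k, hk, hbk⟩ := hbi
        · exact h2 rfl
        · exact h1 k (by omega) hbk
      · exact h1 i hi hbi

/-- A freshly built level has no touched position. -/
theorem touched_next_target :
    ((s.afterQuery a).afterRebuild a s.target π out).touched s.target = ∅ := by
  set t := (s.afterQuery a).afterRebuild a s.target π out with ht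
  ext r
  simp only [touched, Finset.mem_filter, Finset.mem_univ, true_and, Finset.notMem_empty,
    iff_false]
  cases h : index (t.Φ s.target) r.val with
  | none =>
    rw [index_eq_none_iff] at h
    have hc : t.dummyCntr s.target = (t.Φ s.target).card := by simp [ht, afterRebuild]
    simpa [hc] using h
  | some b =>
    obtain ⟨hb, -⟩ := index_eq_some_iff.1 h
    simp only [ne_eq, decide_not, Bool.not_eq_true', decide_eq_false_iff_not, not_not]
    rw [level_eq_iff _ s.target_le hb]
    intro i hi
    simp [ht, afterRebuild, hi]

theorem mergedDict_top (hs : s.WellFormed) (h : s.target = L) :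
    s.mergedDict a s.target = Finset.univ := by
  refine Finset.eq_univ_of_forall fun x => ?_
  refine Finset.mem_insert_of_mem (Finset.mem_biUnion.2 ⟨L, by simp [h], ?_⟩)
  rw [hs.dict_top]
  exact Finset.mem_univ x

theorem card_mergedDict (hs : s.WellFormed) : (s.mergedDict a s.target).card ≤ 2 ^ s.target := by
  rcases s.target_le.lt_or_eq with h | h
  · have h1 : (Finset.range (s.target + 1)).biUnion s.Φ =
        (Finset.range s.target).biUnion s.Φ := by
      rw [Finset.range_add_one, Finset.biUnion_insert,
        hs.dict_of_notMem _ (s.target_notMem h), Finset.empty_union]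
    have h2 : ((Finset.range s.target).biUnion s.Φ).card < 2 ^ s.target :=
      (Finset.card_biUnion_le.trans (Finset.sum_le_sum fun i _ => hs.card_dict i)).trans_lt
        (Nat.geomSum_lt le_rfl fun k hk => Finset.mem_range.1 hk)
    rw [mergedDict, h1]
    exact (Finset.card_insert_le _ _).trans h2
  · rw [hs.mergedDict_top a h, h]
    simp

/-- The invariant is preserved by a request, whatever permutation and table it draws. -/
theorem next (hs : s.WellFormed) : ((s.afterQuery a).afterRebuild a s.target π out).WellFormed where
  le_of_mem j hj := by
    rcases Finset.mem_insert.1 hj with rfl | hj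
    · exact s.target_le
    · exact hs.le_of_mem j (Finset.mem_filter.1 hj).1
  top_mem := by
    rcases s.target_le.lt_or_eq with h | h
    · exact Finset.mem_insert_of_mem (Finset.mem_filter.2 ⟨hs.top_mem, h⟩)
    · exact Finset.mem_insert.2 (Or.inl h.symm)
  dict_top := by
    simp only [afterRebuild]
    split_ifs with h1 h2
    · exact absurd s.target_le (not_le.2 h1)
    · exact hs.mergedDict_top a h2.symm
    · exact hs.dict_top
  dict_of_notMem j hj := by
    simp only [afterRebuild, Finset.mem_insert, Finset.mem_filter, not_or, not_and] at hj ⊢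
    split_ifs with h1 h2
    · rfl
    · exact absurd h2 hj.1
    · exact hs.dict_of_notMem j fun h => hj.2 h (by omega)
  card_dict j := by
    simp only [afterRebuild]
    split_ifs with h1 h2
    · simp
    · rw [h2]
      exact hs.card_mergedDict a
    · exact hs.card_dict j
  card_le_cntr j hj := by
    rcases Finset.mem_insert.1 hj with rfl | hj
    · simp [afterRebuild]
    · obtain ⟨hj, hlt⟩ := Finset.mem_filter.1 hj
      have := hs.card_le_cntr j hj
      simp only [afterRebuild, hlt.ne', hlt.not_gt, if_false, Function.update_of_ne, ne_eq,
        not_false_eq_true, afterQuery]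
      split_ifs <;> omega
  cntr_le j hj := by
    rcases Finset.mem_insert.1 hj with rfl | hj
    · simp [afterRebuild]
    · obtain ⟨hj, hlt⟩ := Finset.mem_filter.1 hj
      have := hs.cntr_le j hj
      have hage := age_rebuild (j := j) (fun i hi => s.mem_of_lt_target hi)
        (hs.target_lt_of_mem hj hlt) hlt
      simp only [afterRebuild, hlt.ne', hlt.not_gt, if_false, Function.update_of_ne, ne_eq,
        not_false_eq_true, afterQuery, hage]
      split_ifs <;> omega
  card_touched j hj := by
    rcases Finset.mem_insert.1 hj with rfl | hj
    · rw [touched_next_target, age, eq_comm, Finset.card_empty]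
      refine Finset.sum_eq_zero fun i hi => ?_
      simp only [afterRebuild, Finset.mem_filter, Finset.mem_insert] at hi
      omega
    · obtain ⟨hj, hlt⟩ := Finset.mem_filter.1 hj
      rw [hs.touched_next a π out hj hlt,
        Finset.card_insert_of_notMem (hs.probe_notMem_touched a hj), hs.card_touched j hj]
      exact (age_rebuild (fun i hi => s.mem_of_lt_target hi) (hs.target_lt_of_mem hj hlt)
        hlt).symm

end State.WellFormed

theorem touched_init (π : Equiv.Perm (Fin (2 ^ (L + 1)))) (db : Addr L → Data B) :
    (init π db).touched L = ∅ := by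
  ext r
  simp only [State.touched, Finset.mem_filter, Finset.mem_univ, true_and, Finset.notMem_empty,
    iff_false]
  cases h : index ((init π db).Φ L) r.val with
  | none =>
    rw [index_eq_none_iff] at h
    simpa [init] using h
  | some b =>
    simp only [ne_eq, decide_not, Bool.not_eq_true', decide_eq_false_iff_not, not_not]
    rw [State.level_eq_iff _ le_rfl (by simp [init])]
    intro i hi
    simp [init, hi.ne]

theorem wellFormed_init (π : Equiv.Perm (Fin (2 ^ (L + 1)))) (db : Addr L → Data B) :
    (init π db).WellFormed where
  le_of_mem j hj := (Finset.mem_singleton.1 hj).le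
  top_mem := Finset.mem_singleton_self L
  dict_top := by simp [init]
  dict_of_notMem j hj := by
    have : j ≠ L := by simpa [init] using hj
    simp [init, this]
  card_dict j := by
    by_cases h : j = L <;> simp [init, h]
  card_le_cntr j hj := by
    obtain rfl := Finset.mem_singleton.1 hj
    simp [init]
  cntr_le j hj := by
    obtain rfl := Finset.mem_singleton.1 hj
    simp [init]
  card_touched j hj := by
    obtain rfl := Finset.mem_singleton.1 hj
    rw [touched_init, age, eq_comm, Finset.card_empty]
    refine Finset.sum_eq_zero fun i hi => ?_
    simp only [init, Finset.mem_filter, Finset.mem_singleton] at hi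
    omega

/-! ### Evictions and the input of the shuffle -/

/-- The accesses of an eviction that moves the cells in a given list. -/
def moveTrace (X : List (ℕ × ℕ)) : List Access :=
  wr .input 0 :: (X.zipIdx 1).flatMap fun c => [rd (.table c.1.1) c.1.2, wr .input c.2]

namespace State

variable (s : State L B) (a : Addr L)

/-- The cells that a rebuild into level `l` may move, as pairs of a level and an index, in the order
of the eviction. -/
def candidates (l : ℕ) : List (ℕ × ℕ) :=
  (s.sources l).flatMap fun j => (List.finRange (2 ^ (j + 1))).map fun i => (j, i.val)

/-- Whether the cell `c`, a pair of a level and an index, is moved. -/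
def moved (c : ℕ × ℕ) : Bool :=
  s.kept a c.1 ((s.perm c.1).symm (Fin.ofNat _ c.2))

theorem map_evictAll (l : ℕ) : (s.evictAll a l).map (fun c => (c.1, c.2.1)) =
    (s.candidates l).filter (s.moved a) := by
  rw [evictAll, candidates, List.map_flatMap, List.filter_flatMap]
  congr 1
  funext j
  have h : ((s.evict a j).map Prod.fst).map (Prod.mk j) =
      ((List.finRange (2 ^ (j + 1))).map fun i => (j, i.val)).filter (s.moved a) := by
    rw [map_fst_evict, List.filter_map, List.map_map]
    congr 1
    refine List.filter_congr fun i _ => ?_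
    simp [moved]
  rw [← h, List.map_map, List.map_map]
  rfl

theorem evictTrace_eq (l : ℕ) :
    s.evictTrace a l = moveTrace ((s.candidates l).filter (s.moved a)) := by
  rw [evictTrace, moveTrace, ← map_evictAll, List.zipIdx_map, List.flatMap_map]
  rfl

theorem length_evictAll (l : ℕ) :
    (s.evictAll a l).length = ((s.candidates l).filter (s.moved a)).length := by
  rw [← map_evictAll, List.length_map]

/-- The address of the block in cell `i` of level `j`, if the eviction moves it. -/
def movedBlock (j : ℕ) (i : Fin (2 ^ (j + 1))) : Option (Addr L) :=
  (index (s.Φ j) ((s.perm j).symm i).val).filter fun b => decide (s.level b = j ∧ b ≠ a)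

theorem movedBlock_eq_some {j : ℕ} {i : Fin (2 ^ (j + 1))} {b : Addr L}
    (h : s.movedBlock a j i = some b) :
    (b ∈ s.Φ j ∧ rank (s.Φ j) b = ((s.perm j).symm i).val) ∧ s.level b = j ∧ b ≠ a := by
  rw [movedBlock, Option.filter_eq_some_iff] at h
  exact ⟨index_eq_some_iff.1 h.1, of_decide_eq_true h.2⟩

theorem filterMap_evict (j : ℕ) :
    ((s.evict a j).filterMap fun c => c.2.map Prod.fst) =
      (List.finRange (2 ^ (j + 1))).filterMap (s.movedBlock a j) := by
  rw [evict, List.filterMap_filterMap]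
  congr 1
  funext i
  dsimp only [movedBlock]
  cases index (s.Φ j) ((s.perm j).symm i).val with
  | none =>
    by_cases hc : s.dummyCntr j ≤ ((s.perm j).symm i).val <;> simp [hc]
  | some b =>
    by_cases hc : s.level b = j ∧ b ≠ a <;> simp [hc, Option.filter]

/-- The addresses of the blocks in the input of the shuffle. -/
def inputBlocks (l : ℕ) : List (Addr L) :=
  a :: (s.sources l).flatMap fun j => (List.finRange (2 ^ (j + 1))).filterMap (s.movedBlock a j)

theorem filterMap_shuffleInput (data : Data B) (l : ℕ) :
    ((s.shuffleInput a data l).filterMap fun c => c.map Prod.fst) =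
      (s.inputBlocks a l).map fun b =>
        Fin.ofNat (2 ^ (l + 1)) (slot l (s.mergedDict a l) b) := by
  have h : ((s.evictAll a l).filterMap fun c => c.2.2.map Prod.fst) =
      (s.sources l).flatMap fun j =>
        (List.finRange (2 ^ (j + 1))).filterMap (s.movedBlock a j) := by
    rw [evictAll, List.filterMap_flatMap]
    congr 1
    funext j
    rw [← filterMap_evict, List.filterMap_map]
    rfl
  rw [shuffleInput, inputBlocks, ← h, List.filterMap_map, List.map_cons, List.map_filterMap,
    List.filterMap_cons, List.filterMap_map]
  simp only [Function.comp_def, Option.map_map, Option.map_some]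

theorem nodup_inputBlocks (l : ℕ) : (s.inputBlocks a l).Nodup := by
  rw [inputBlocks, List.nodup_cons]
  constructor
  · intro h
    obtain ⟨j, -, h⟩ := List.mem_flatMap.1 h
    obtain ⟨i, -, h⟩ := List.mem_filterMap.1 h
    exact (s.movedBlock_eq_some a h).2.2 rfl
  · rw [List.nodup_flatMap]
    constructor
    · intro j _
      refine (List.nodup_finRange _).filterMap fun i i' b hi hi' => ?_
      have h1 := (s.movedBlock_eq_some a hi).1.2
      have h2 := (s.movedBlock_eq_some a hi').1.2
      exact (s.perm j).symm.injective (Fin.ext (h1.symm.trans h2))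
    · have hsort : (s.sources l).Pairwise (· ≠ ·) := Finset.sort_nodup _ _
      refine hsort.imp fun {j k} hjk => ?_
      rw [Function.onFun, List.disjoint_left]
      intro b hb hb'
      obtain ⟨i, -, h⟩ := List.mem_filterMap.1 hb
      obtain ⟨i', -, h'⟩ := List.mem_filterMap.1 hb'
      exact hjk ((s.movedBlock_eq_some a h).2.1.symm.trans (s.movedBlock_eq_some a h').2.1)

theorem mem_mergedDict_of_mem_inputBlocks {l : ℕ} {b : Addr L} (h : b ∈ s.inputBlocks a l) :
    b ∈ s.mergedDict a l := by
  rcases List.mem_cons.1 h with rfl | h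
  · exact Finset.mem_insert_self _ _
  · obtain ⟨j, hj, h⟩ := List.mem_flatMap.1 h
    obtain ⟨i, -, h⟩ := List.mem_filterMap.1 h
    have hj' := (Finset.mem_filter.1 ((Finset.mem_sort _).1 hj)).2
    exact Finset.mem_insert_of_mem (Finset.mem_biUnion.2
      ⟨j, Finset.mem_range.2 (by omega), (s.movedBlock_eq_some a h).1.1⟩)

end State

theorem State.length_evict (s : State L B) (a : Addr L) (j : ℕ) :
    (s.evict a j).length = (Finset.univ.filter fun r => s.kept a j r = true).card := by
  rw [← List.length_map (f := Prod.fst), map_fst_evict, List.length_map,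
    ← List.toFinset_card_of_nodup ((List.nodup_finRange _).filter _),
    ← Finset.card_map (s.perm j).symm.toEmbedding]
  congr 1
  ext i
  simp [Finset.mem_map_equiv]

theorem State.length_evictAll_eq_sum (s : State L B) (a : Addr L) (l : ℕ) :
    (s.evictAll a l).length = ∑ j ∈ s.occupied.filter (· ≤ l),
      (Finset.univ.filter fun r => s.kept a j r = true).card := by
  rw [evictAll, List.length_flatMap, ← Finset.sort_toFinset
    (s.occupied.filter (· ≤ l)) (· ≤ ·), List.sum_toFinset _ (Finset.sort_nodup _ _)]
  simp only [List.length_map, length_evict]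
  rfl

namespace State.WellFormed

variable {s : State L B} (a : Addr L)

theorem card_kept (hs : s.WellFormed) {j : ℕ} (hj : j ∈ s.occupied) :
    (Finset.univ.filter fun r => (s.afterQuery a).kept a j r = true).card +
      (age s.occupied j + 1) = 2 ^ (j + 1) := by
  have h : (Finset.univ.filter fun r => (s.afterQuery a).kept a j r = true) =
      (insert (s.probe a j) (s.touched j))ᶜ := by
    ext r
    rw [Finset.mem_filter, Finset.mem_compl, hs.kept_iff a hj]
    simp
  rw [h, ← hs.card_touched j hj,
    ← Finset.card_insert_of_notMem (hs.probe_notMem_touched a hj), Finset.card_compl_add_card,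
    Fintype.card_fin]

/-- Each merged level `j` contributes `2 ^ j` untouched cells, so that they and the accessed block
fit into the rebuilt table. -/
theorem length_evictAll_lt (hs : s.WellFormed) :
    ((s.afterQuery a).evictAll a s.target).length < 2 ^ (s.target + 1) := by
  rw [length_evictAll_eq_sum]
  change ∑ j ∈ s.occupied.filter (· ≤ s.target), _ < _
  have hle : ∀ j ∈ s.occupied.filter (· ≤ s.target),
      (Finset.univ.filter fun r => (s.afterQuery a).kept a j r = true).card = 2 ^ j := by
    intro j hj
    obtain ⟨hj, hjt⟩ := Finset.mem_filter.1 hj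
    have h1 := hs.card_kept a hj
    rw [age_of_forall_mem fun i hi => s.mem_of_lt_target (by omega)] at h1
    have h2 := pow_succ 2 j
    omega
  rw [Finset.sum_congr rfl hle]
  exact Nat.geomSum_lt le_rfl fun k hk => Nat.lt_succ_of_le (Finset.mem_filter.1 hk).2

/-- Obliviousness of the shuffle applies to the inputs that RankORAM passes to it. -/
theorem shuffleInput_valid (hs : s.WellFormed) (data : Data B) :
    ((s.afterQuery a).shuffleInput a data s.target).Valid := by
  constructor
  · have := hs.length_evictAll_lt a
    simp only [shuffleInput, List.length_map, List.length_cons]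
    omega
  · rw [filterMap_shuffleInput]
    refine List.Nodup.map_on ?_ (nodup_inputBlocks _ _ _)
    have hslot : ∀ b, slot s.target ((s.afterQuery a).mergedDict a s.target) b =
        rank (s.mergedDict a s.target) b := fun b => slot_eq_rank (fun h =>
      hs.mergedDict_top a (le_antisymm s.target_le h)) b
    have hcard := hs.card_mergedDict a
    have hmod : ∀ b ∈ (s.afterQuery a).inputBlocks a s.target,
        b ∈ s.mergedDict a s.target ∧
          (Fin.ofNat (2 ^ (s.target + 1))
            (slot s.target ((s.afterQuery a).mergedDict a s.target) b)).val =
              rank (s.mergedDict a s.target) b := by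
      intro b hb
      have hb' : b ∈ s.mergedDict a s.target := mem_mergedDict_of_mem_inputBlocks _ _ hb
      have := rank_lt_card hb'
      refine ⟨hb', ?_⟩
      rw [Fin.val_ofNat, hslot, Nat.mod_eq_of_lt (by rw [pow_succ]; omega)]
    intro b hb c hc h
    have h' := congrArg Fin.val h
    rw [(hmod b hb).2, (hmod c hc).2] at h'
    exact rank_injOn _ (hmod b hb).1 (hmod c hc).1 h'

end State.WellFormed

/-! ### The bits of transcripts as functions of low complexity -/

section BitsComputed

variable {Ω : Type} {base : Set (Ω → Bool)} {m : ℕ}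

/-- All bits of a transcript that depends on `ω` have straight-line complexity at most `m`. -/
def BitsComputed (base : Set (Ω → Bool)) (m : ℕ) (g : Ω → Transcript) : Prop :=
  ∀ i, Computes base {fun ω => transcriptBits (g ω) i} m

theorem BitsComputed.const (T : Transcript) (hm : 1 ≤ m) : BitsComputed base m fun _ => T :=
  fun i => (Computes.const (transcriptBits T i)).mono subset_rfl hm

theorem BitsComputed.cons {x : Ω → List Access} {g : Ω → Transcript} (hm : 1 ≤ m)
    (hx : ∀ i, Computes base {fun ω => traceBits (x ω) i} m) (hg : BitsComputed base m g) :
    BitsComputed base m fun ω => x ω :: g ω := by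
  rintro ⟨p, i⟩
  cases p with
  | zero =>
    cases i with
    | none => simpa [transcriptBits] using (Computes.const true).mono subset_rfl hm
    | some i => simpa [transcriptBits] using hx i
  | succ p =>
    cases i with
    | none => simpa [transcriptBits] using hg (p, none)
    | some i => simpa [transcriptBits] using hg (p, some i)

theorem BitsComputed.append {g : Ω → Transcript} (hm : 1 ≤ m) (P : Transcript)
    (hg : BitsComputed base m g) : BitsComputed base m fun ω => P ++ g ω := by
  induction P with
  | nil => exact hg
  | cons x P ih =>
    exact ih.cons hm fun i => (Computes.const (traceBits x i)).mono subset_rfl hm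

end BitsComputed

/-- Every bit of the trace of an eviction is either constant or a bit of one of the moved cells. -/
theorem traceBits_moveTrace (i : TraceBit) :
    (∃ b, ∀ X, traceBits (moveTrace X) i = b) ∨
      ∃ (e : ℕ) (v : ℕ × ℕ → Bool), ∀ X : List (ℕ × ℕ),
        traceBits (moveTrace X) i = ((X[e]?).map v).getD false := by
  have hpair : ∀ (f g : (ℕ × ℕ) × ℕ → Access) (Y : List ((ℕ × ℕ) × ℕ)) (e : ℕ),
      (Y.flatMap fun c => [f c, g c])[2 * e]? = (Y[e]?).map f ∧
        (Y.flatMap fun c => [f c, g c])[2 * e + 1]? = (Y[e]?).map g := by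
    intro f g Y
    induction Y with
    | nil => simp
    | cons c Y ih =>
      rintro (_ | e)
      · simp
      · simpa [Nat.mul_succ] using ih e
  have hbit : ∀ (e : ℕ) (h : Access → Bool),
      (∃ b, ∀ X, (((moveTrace X)[e]?).map h).getD false = b) ∨
      ∃ (k : ℕ) (v : ℕ × ℕ → Bool), ∀ X : List (ℕ × ℕ),
        (((moveTrace X)[e]?).map h).getD false = ((X[k]?).map v).getD false := by
    intro e h
    rcases e with _ | e
    · exact Or.inl ⟨h (wr .input 0), fun X => rfl⟩
    · right
      obtain ⟨k, rfl | rfl⟩ := Nat.even_or_odd' e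
      · refine ⟨k, fun c => h (rd (.table c.1) c.2), fun X => ?_⟩
        rw [moveTrace, List.getElem?_cons_succ, (hpair _ _ _ _).1, List.getElem?_zipIdx]
        cases X[k]? <;> rfl
      · refine ⟨k, fun c => h (wr .input (1 + k)), fun X => ?_⟩
        rw [moveTrace, List.getElem?_cons_succ, (hpair _ _ _ _).2, List.getElem?_zipIdx]
        cases X[k]? <;> rfl
  cases i with
  | present e =>
    have hp : ∀ tr : List Access,
        traceBits tr (.present e) = ((tr[e]?).map fun _ => true).getD false := by
      intro tr
      by_cases h : e < tr.length
      · simp [traceBits, h]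
      · simp [traceBits, h]
    simpa only [hp] using hbit e fun _ => true
  | isWrite e => exact hbit e _
  | array e b => exact hbit e fun a => a.array.code.testBit b
  | index e b => exact hbit e fun a => a.index.testBit b

/-- The state with another permutation of level `l`. -/
def State.withPerm (s : State L B) (l : ℕ) (π : Equiv.Perm (Fin (2 ^ (l + 1)))) : State L B :=
  { s with perm := Function.update s.perm l π }

/-- The accesses of the batched query for `a`. -/
def State.queryTrace (s : State L B) (a : Addr L) : List Access :=
  (s.query a).map fun c => rd (.table c.1) c.2

theorem computes_queryTrace (s : State L B) (a : Addr L) (l : ℕ) (i : TraceBit) :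
    Computes (permAtoms (l + 1)) {fun π => traceBits ((s.withPerm l π).queryTrace a) i} 1 := by
  have hq : ∀ π, (s.withPerm l π).queryTrace a = s.occupied.sort.map fun j =>
      rd (.table j) ((s.withPerm l π).perm j (s.probe a j)).val := by
    intro π
    rw [State.queryTrace, State.query_eq, List.map_map]
    rfl
  have hget : ∀ (π : Equiv.Perm (Fin (2 ^ (l + 1)))) (e : ℕ),
      ((s.withPerm l π).queryTrace a)[e]? = (s.occupied.sort[e]?).map fun j =>
      rd (.table j) ((s.withPerm l π).perm j (s.probe a j)).val := by
    intro π e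
    rw [hq, List.getElem?_map]
  cases i with
  | present e => simpa [traceBits, hq] using Computes.const (decide (e < s.occupied.card))
  | isWrite e =>
    simp only [traceBits, hget]
    cases s.occupied.sort[e]? <;> exact Computes.const _
  | array e b =>
    simp only [traceBits, hget]
    cases s.occupied.sort[e]? with
    | none => exact Computes.const _
    | some j => exact Computes.const ((j + 2).testBit b)
  | index e b =>
    simp only [traceBits, hget]
    cases s.occupied.sort[e]? with
    | none => exact Computes.const _
    | some j =>
      by_cases hj : j = l
      · subst hj
        refine Computes.atom ⟨s.probe a j, b, ?_⟩
        funext π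
        simp [State.withPerm, rd]
      · refine (Computes.const ((s.perm j (s.probe a j)).val.testBit b)).mono ?_ le_rfl
        rintro _ rfl
        funext π
        have hp : (s.withPerm l π).perm j = s.perm j := Function.update_of_ne hj ..
        simp [hp, rd]

/-- A bound for the number of cells that a rebuild may move. -/
def cellBound (L : ℕ) : ℕ := (L + 1) * 2 ^ (L + 1)

/-- A bound for the complexity of deciding from its permutation whether a cell is moved. -/
def flagBound (L : ℕ) : ℕ := 2 ^ (L + 1) * ((L + 1) * 5 + 5) + 1

/-- A bound for the complexity of the bits of the traces as functions of one permutation. -/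
def traceBound (L : ℕ) : ℕ :=
  cellBound L * (flagBound L + 4 * (cellBound L + 1) + 2) + 2

theorem one_le_traceBound (L : ℕ) : 1 ≤ traceBound L := by
  rw [traceBound]
  omega

theorem State.length_candidates_le (s : State L B) {l : ℕ} (hl : l ≤ L) :
    (s.candidates l).length ≤ cellBound L := by
  rw [candidates, List.length_flatMap]
  simp only [List.length_map, List.length_finRange]
  have h1 : ∀ x ∈ (s.sources l).map fun j => 2 ^ (j + 1), x ≤ 2 ^ (L + 1) := by
    intro x hx
    obtain ⟨j, hj, rfl⟩ := List.mem_map.1 hx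
    have := (Finset.mem_filter.1 ((Finset.mem_sort _).1 hj)).2
    exact Nat.pow_le_pow_right two_pos (by omega)
  have h2 : (s.sources l).length ≤ L + 1 := by
    rw [sources, Finset.length_sort]
    refine (Finset.card_le_card (t := Finset.range (L + 1)) fun j hj => ?_).trans (by simp)
    have := (Finset.mem_filter.1 hj).2
    exact Finset.mem_range.2 (by omega)
  refine (List.sum_le_card_nsmul _ _ h1).trans ?_
  rw [List.length_map, smul_eq_mul]
  exact Nat.mul_le_mul_right _ h2

theorem computes_evictTrace (s : State L B) (a : Addr L) {l t : ℕ} (hl : l ≤ L) (ht : t ≤ L)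
    (i : TraceBit) : Computes (permAtoms (l + 1))
      {fun π => traceBits ((s.withPerm l π).evictTrace a t) i} (traceBound L) := by
  have hflag : ∀ c ∈ s.candidates t,
      Computes (permAtoms (l + 1)) {fun π => (s.withPerm l π).moved a c} (flagBound L) := by
    rintro ⟨j, n⟩ -
    by_cases hj : j = l
    · subst hj
      refine (computes_symm_perm (s.kept a j) (Fin.ofNat _ n)).mono ?_ ?_
      · rintro _ rfl
        funext π
        have hp : (s.withPerm j π).perm j = π := Function.update_self ..
        simp only [State.moved, hp]
        rfl
      · rw [flagBound]
        gcongr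
        exact one_le_two
    · refine (Computes.const (s.moved a (j, n))).mono ?_ (by rw [flagBound]; omega)
      rintro _ rfl
      funext π
      have hp : (s.withPerm l π).perm j = s.perm j := Function.update_of_ne hj ..
      simp only [State.moved, hp]
      rfl
  have htr : ∀ π, (s.withPerm l π).evictTrace a t =
      moveTrace ((s.candidates t).filter ((s.withPerm l π).moved a)) := fun π =>
    (s.withPerm l π).evictTrace_eq a t
  simp only [htr]
  rcases traceBits_moveTrace i with ⟨b, hb⟩ | ⟨e, v, hv⟩
  · simp only [hb]
    exact (Computes.const b).mono subset_rfl (one_le_traceBound L)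
  · simp only [hv]
    refine (Computes.filter_getElem? (s.candidates t) (fun π => (s.withPerm l π).moved a) v hflag
      e).mono subset_rfl ?_
    have := s.length_candidates_le ht
    rw [traceBound]
    gcongr

/-! ### The ideal world -/

variable (S : ShuffleAlg) (sec : ℕ)

/-- The trace of the shuffle on an input of `n` dummies. -/
noncomputable def simulatedShuffle (l B n : ℕ) : PMF (List Access) :=
  (S.run sec l B (List.replicate n none) (Equiv.refl _)).map Prod.fst

/-- The transcript in the ideal world: permutations are uniformly random, and the trace of every
shuffle is that of an array of dummies of the same length. -/
noncomputable def idealTranscript : List (Request L B) → State L B → PMF Transcript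
  | [], _ => PMF.pure []
  | q :: qs, s =>
      (PMF.uniformOfFintype (Equiv.Perm (Fin (2 ^ (s.target + 1))))).bind fun π =>
        (simulatedShuffle S sec s.target B
            (((s.afterQuery q.addr).evictAll q.addr s.target).length + 1)).bind fun tr =>
          (idealTranscript qs
            ((s.afterQuery q.addr).afterRebuild q.addr s.target π fun _ => none)).map fun T =>
              [s.queryTrace q.addr, (s.afterQuery q.addr).evictTrace q.addr s.target, tr] ++ T

/-- Locations do not depend on contents. -/
theorem idealTranscript_withTable (qs : List (Request L B)) (s : State L B)
    (tb : ℕ → ℕ → Option (Data B)) :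
    idealTranscript S sec qs { s with table := tb } = idealTranscript S sec qs s := by
  induction qs generalizing s tb with
  | nil => rfl
  | cons q qs ih =>
    simp only [idealTranscript]
    refine congrArg (PMF.bind _) (funext fun π => ?_)
    have h1 : ((State.afterQuery { s with table := tb } q.addr).evictAll q.addr
        s.target).length = ((s.afterQuery q.addr).evictAll q.addr s.target).length := by
      rw [State.length_evictAll_eq_sum, State.length_evictAll_eq_sum]
      rfl
    have h2 : (State.afterQuery { s with table := tb } q.addr).evictTrace q.addr s.target =
        (s.afterQuery q.addr).evictTrace q.addr s.target := by
      rw [State.evictTrace_eq, State.evictTrace_eq]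
      rfl
    have h3 := ih ((s.afterQuery q.addr).afterRebuild q.addr s.target π fun _ => none)
      (Function.update tb s.target fun _ => none)
    change (simulatedShuffle S sec s.target B
      (((State.afterQuery { s with table := tb } q.addr).evictAll q.addr
        s.target).length + 1)).bind _ = _
    rw [h1]
    refine congrArg (PMF.bind _) (funext fun tr => ?_)
    change PMF.map (fun T => [s.queryTrace q.addr,
      (State.afterQuery { s with table := tb } q.addr).evictTrace q.addr s.target, tr] ++ T)
        (idealTranscript S sec qs { (s.afterQuery q.addr).afterRebuild q.addr s.target π
          fun _ => none with table := Function.update tb s.target fun _ => none }) = _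
    rw [h2, h3]

/-- As a function of one of the permutations, the transcript in the ideal world is a mixture of
functions of low complexity. -/
theorem idealTranscript_mixture {l : ℕ} (hl : l ≤ L) (qs : List (Request L B)) (s : State L B) :
    ∃ μ : PMF (Equiv.Perm (Fin (2 ^ (l + 1))) → Transcript),
      (∀ g ∈ μ.support, BitsComputed (permAtoms (l + 1)) (traceBound L) g) ∧
        ∀ π, idealTranscript S sec qs (s.withPerm l π) = μ.map fun g => g π := by
  have h1 := one_le_traceBound L
  induction qs generalizing s with
  | nil =>
    refine ⟨PMF.pure fun _ => [], fun g hg => ?_, fun π => ?_⟩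
    · rw [PMF.support_pure, Set.mem_singleton_iff] at hg
      subst hg
      exact .const _ h1
    · rw [PMF.pure_map]
      rfl
  | cons q qs ih =>
    set a := q.addr with ha
    -- The permutation of level `l` plays no role any more once level `l` is rebuilt.
    have hrest : ∀ π' : Equiv.Perm (Fin (2 ^ (s.target + 1))),
        ∃ μ : PMF (Equiv.Perm (Fin (2 ^ (l + 1))) → Transcript),
          (∀ g ∈ μ.support, BitsComputed (permAtoms (l + 1)) (traceBound L) g) ∧
            ∀ π, idealTranscript S sec qs (((s.withPerm l π).afterQuery a).afterRebuild a
              s.target π' fun _ => none) = μ.map fun g => g π := by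
      intro π'
      by_cases hlt : l = s.target
      · subst hlt
        refine ⟨(idealTranscript S sec qs ((s.afterQuery a).afterRebuild a s.target π'
          fun _ => none)).map fun T _ => T, fun g hg => ?_, fun π => ?_⟩
        · obtain ⟨T, -, rfl⟩ := (PMF.mem_support_map_iff _ _ _).1 hg
          exact .const _ h1
        · have hst : ((s.withPerm s.target π).afterQuery a).afterRebuild a s.target π'
              (fun _ => none) =
                (s.afterQuery a).afterRebuild a s.target π' fun _ => none := by
            simp only [State.afterRebuild, State.withPerm, State.afterQuery, Function.update_idem]
            rfl
          rw [hst, PMF.map_comp]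
          exact (PMF.map_id _).symm
      · obtain ⟨μ, hμ, hμ'⟩ := ih ((s.afterQuery a).afterRebuild a s.target π' fun _ => none)
        refine ⟨μ, hμ, fun π => ?_⟩
        rw [← hμ']
        congr 1
        simp only [State.afterRebuild, State.withPerm, State.afterQuery]
        rw [Function.update_comm hlt]
        rfl
    choose μ hμ hμ' using hrest
    refine ⟨(PMF.uniformOfFintype _).bind fun π' => (simulatedShuffle S sec s.target B
      (((s.afterQuery a).evictAll a s.target).length + 1)).bind fun tr => (μ π').map fun g π =>
        [(s.withPerm l π).queryTrace a, ((s.afterQuery a).withPerm l π).evictTrace a s.target,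
          tr] ++ g π, fun g hg => ?_, fun π => ?_⟩
    · obtain ⟨π', -, hg⟩ := (PMF.mem_support_bind_iff _ _ _).1 hg
      obtain ⟨tr, -, hg⟩ := (PMF.mem_support_bind_iff _ _ _).1 hg
      obtain ⟨g', hg', rfl⟩ := (PMF.mem_support_map_iff _ _ _).1 hg
      refine .cons h1 (fun i => (computes_queryTrace s a l i).mono subset_rfl h1) ?_
      refine .cons h1 (computes_evictTrace _ a hl s.target_le) ?_
      exact .cons h1 (fun i => (Computes.const _).mono subset_rfl h1) (hμ π' g' hg')
    · have hlen : (((s.withPerm l π).afterQuery a).evictAll a s.target).length =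
          ((s.afterQuery a).evictAll a s.target).length := by
        rw [State.length_evictAll_eq_sum, State.length_evictAll_eq_sum]
        rfl
      simp only [PMF.map_bind, PMF.map_comp]
      change (PMF.uniformOfFintype (Equiv.Perm (Fin (2 ^ (s.target + 1))))).bind (fun π' =>
        (simulatedShuffle S sec s.target B
            ((((s.withPerm l π).afterQuery a).evictAll a s.target).length + 1)).bind fun tr =>
          (idealTranscript S sec qs (((s.withPerm l π).afterQuery a).afterRebuild a s.target π'
            fun _ => none)).map fun T => [(s.withPerm l π).queryTrace a,
              ((s.withPerm l π).afterQuery a).evictTrace a s.target, tr] ++ T) = _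
      simp only [hlen, hμ', PMF.map_comp]
      rfl

end RankORAM

/-! ### The real world is indistinguishable from the ideal world -/

namespace RankORAM

/-- The test that a circuit performs on a transcript. -/
def transcriptTest (C : Circuit (ℕ × Option TraceBit) Empty) (T : Transcript) : Bool :=
  C.eval (transcriptBits T) fun o => o.elim

/-- The access pattern in the ideal world, with a uniformly random initial permutation. -/
noncomputable def idealPattern {L B : ℕ} (S : ShuffleAlg) (sec : ℕ) (db : Addr L → Data B)
    (y : List (Request L B)) : PMF Transcript :=
  (PMF.uniformOfFintype (Equiv.Perm (Fin (2 ^ (L + 1))))).bind fun π =>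
    idealTranscript S sec y (init π db)

/-- At one security parameter, `ε` bounds the advantages of the circuits with at most `m` gates
against the permutations of domains up to the size of the largest table. -/
def PermSecure (F : PermFamily) (sec L m : ℕ) (ε : ℝ) : Prop :=
  ∀ d ≤ L + 1, ∀ D : Circuit Empty Unit, D.length ≤ m →
    |acceptProb (F.fresh sec d) (fun π => D.eval (fun i => i.elim) (permOracle π)) -
      acceptProb (PMF.uniformOfFintype (Equiv.Perm (Fin (2 ^ d))))
        (fun π => D.eval (fun i => i.elim) (permOracle π))| ≤ ε

/-- At one security parameter, `ε` bounds the advantages of the circuits with at most `m` gates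
against the shuffle for tables up to the largest one. -/
def ShuffleSecure (S : ShuffleAlg) (sec L B m : ℕ) (ε : ℝ) : Prop :=
  ∀ l ≤ L, ∀ (I J : ShuffleInput l B) (π ρ : Equiv.Perm (Fin (2 ^ (l + 1)))),
    I.Valid → J.Valid → I.length = J.length →
      ∀ D : Circuit TraceBit Empty, D.length ≤ m →
        |acceptProb ((S.run sec l B I π).map Prod.fst)
            (fun tr => D.eval (traceBits tr) fun o => o.elim) -
          acceptProb ((S.run sec l B J ρ).map Prod.fst)
            (fun tr => D.eval (traceBits tr) fun o => o.elim)| ≤ ε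

section Hybrid

variable {L B : ℕ} {F : PermFamily} {S : ShuffleAlg} {sec m : ℕ} {εP εS : ℝ}
  {C : Circuit (ℕ × Option TraceBit) Empty}

/-- Replacing a permutation of the family by a uniformly random one goes unnoticed if the transcript
is a mixture of functions of low complexity: composed with `C`, each becomes an oracle circuit. -/
theorem abs_sub_le_of_permSecure (hP : PermSecure F sec L m εP)
    (hC : C.length * (traceBound L + 1) + 5 ≤ m) {d : ℕ} (hd : d ≤ L + 1)
    (μ : PMF (Equiv.Perm (Fin (2 ^ d)) → Transcript))
    (hμ : ∀ g ∈ μ.support, BitsComputed (permAtoms d) (traceBound L) g) :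
    |acceptProb ((F.fresh sec d).bind fun π => μ.map fun g => g π) (transcriptTest C) -
      acceptProb ((PMF.uniformOfFintype (Equiv.Perm (Fin (2 ^ d)))).bind fun π =>
        μ.map fun g => g π) (transcriptTest C)| ≤ εP := by
  have hcomm : ∀ p : PMF (Equiv.Perm (Fin (2 ^ d))),
      (p.bind fun π => μ.map fun g => g π) = μ.bind fun g => p.map g := by
    intro p
    simp only [PMF.map, Function.comp_def]
    exact PMF.bind_comm _ _ _
  rw [hcomm, hcomm]
  refine abs_acceptProb_bind_sub_le _ _ _ _ _ fun g hg => ?_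
  obtain ⟨D, hD, hDe⟩ := (C.computes_eval (fun π => transcriptBits (g π)) _
    (hμ g hg)).exists_circuit (ι := Empty) (fun _ i => i.elim) permOracle permAtoms_gate
  have h := hP d hd D (by omega)
  simp only [hDe] at h
  rw [acceptProb_map, acceptProb_map]
  exact h

/-- The trace of one shuffle can be replaced when the rest of the transcript is independent of it:
for every value of the rest, `C` becomes a circuit that reads the bits of the trace. -/
theorem abs_sub_le_of_shuffleSecure (hS : ShuffleSecure S sec L B m εS)
    (hC : C.length * (traceBound L + 1) + 5 ≤ m) {l : ℕ} (hl : l ≤ L)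
    {I J : ShuffleInput l B} (π ρ : Equiv.Perm (Fin (2 ^ (l + 1)))) (hI : I.Valid)
    (hJ : J.Valid) (hIJ : I.length = J.length) (P : Transcript) (x y : List Access)
    (q : PMF Transcript) :
    |acceptProb (((S.run sec l B I π).map Prod.fst).bind fun tr =>
        q.map fun T => P ++ ([x, y, tr] ++ T)) (transcriptTest C) -
      acceptProb (((S.run sec l B J ρ).map Prod.fst).bind fun tr =>
        q.map fun T => P ++ ([x, y, tr] ++ T)) (transcriptTest C)| ≤ εS := by
  have hcomm : ∀ p : PMF (List Access), (p.bind fun tr => q.map fun T => P ++ ([x, y, tr] ++ T)) =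
      q.bind fun T => p.map fun tr => P ++ ([x, y, tr] ++ T) := by
    intro p
    simp only [PMF.map, Function.comp_def]
    exact PMF.bind_comm _ _ _
  rw [hcomm, hcomm]
  refine abs_acceptProb_bind_sub_le _ _ _ _ _ fun T _ => ?_
  have hbits : BitsComputed {f | ∃ i, f = fun tr => traceBits tr i} 1
      fun tr => P ++ ([x, y, tr] ++ T) :=
    .append le_rfl P <| .append le_rfl [x, y] <|
      .cons le_rfl (fun i => .atom ⟨i, rfl⟩) <| .const T le_rfl
  obtain ⟨D, hD, hDe⟩ := (C.computes_eval (fun tr => transcriptBits (P ++ ([x, y, tr] ++ T))) _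
    hbits).exists_circuit (κ := Empty) traceBits (fun _ o => o.elim) (by
      rintro _ ⟨i, rfl⟩
      exact ⟨.input i, fun _ _ => rfl⟩)
  have hDm : D.length ≤ m := by
    have := Nat.mul_le_mul_left C.length
      (Nat.add_le_add_right (one_le_traceBound L) 1)
    omega
  have h := hS l hl I J π ρ hI hJ hIJ D hDm
  simp only [hDe] at h
  rw [acceptProb_map (_ : PMF (List Access)), acceptProb_map (_ : PMF (List Access))]
  exact h

theorem valid_replicate_none {l n : ℕ} (hn : n ≤ 2 ^ (l + 1)) :
    ShuffleInput.Valid (l := l) (B := B) (List.replicate n none) := by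
  refine ⟨by simpa using hn, ?_⟩
  rw [List.filterMap_eq_nil_iff.2 (by
    intro c hc
    rw [List.eq_of_mem_replicate hc]
    rfl)]
  exact List.nodup_nil

/-- The hybrid argument. The prefix `P` stands for the transcript of the requests already served; it
is the same in both worlds. -/
theorem abs_transcript_sub_idealTranscript_le (hP : PermSecure F sec L m εP)
    (hS : ShuffleSecure S sec L B m εS) (hC : C.length * (traceBound L + 1) + 5 ≤ m)
    (y : List (Request L B)) (s : State L B) (hs : s.WellFormed) (P : Transcript) :
    |acceptProb ((transcript F S sec y s).map (P ++ ·)) (transcriptTest C) -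
      acceptProb ((idealTranscript S sec y s).map (P ++ ·)) (transcriptTest C)| ≤
        y.length * (εP + εS) := by
  induction y generalizing s P with
  | nil => simp [transcript, idealTranscript]
  | cons q qs ih =>
    obtain ⟨data, hdata⟩ : ∃ data : Data B, data = (match q with
      | .read _ => s.lookup q.addr
      | .write _ data' => data') := ⟨_, rfl⟩
    set a := q.addr with ha
    set x := s.queryTrace a with hx
    set z := (s.afterQuery a).evictTrace a s.target with hz
    set I := (s.afterQuery a).shuffleInput a data s.target with hI
    set n := ((s.afterQuery a).evictAll a s.target).length + 1 with hn
    have hIn : I.length = n := by simp [hI, hn, State.shuffleInput]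
    have hl := s.target_le
    let next := fun (π : Equiv.Perm (Fin (2 ^ (s.target + 1)))) (out : ℕ → Option (Data B)) =>
      (s.afterQuery a).afterRebuild a s.target π out
    have hreal : (transcript F S sec (q :: qs) s).map (P ++ ·) =
        (F.fresh sec (s.target + 1)).bind fun π => (S.run sec s.target B I π).bind fun o =>
          (transcript F S sec qs (next π o.2)).map fun T => P ++ ([x, z, o.1] ++ T) := by
      rw [hI, hdata]
      simp only [transcript, access, PMF.bind_bind, PMF.bind_map, PMF.map_bind, Function.comp_def,
        PMF.map_comp]
      rfl
    have hideal : (idealTranscript S sec (q :: qs) s).map (P ++ ·) =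
        (PMF.uniformOfFintype (Equiv.Perm (Fin (2 ^ (s.target + 1))))).bind fun π =>
          (simulatedShuffle S sec s.target B n).bind fun tr =>
            (idealTranscript S sec qs (next π fun _ => none)).map fun T =>
              P ++ ([x, z, tr] ++ T) := by
      simp only [idealTranscript, PMF.map_bind, PMF.map_comp]
      rfl
    -- The remaining requests move to the ideal world, by induction.
    have h1 : |acceptProb ((F.fresh sec (s.target + 1)).bind fun π =>
        (S.run sec s.target B I π).bind fun o =>
          (transcript F S sec qs (next π o.2)).map fun T => P ++ ([x, z, o.1] ++ T))
            (transcriptTest C) -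
        acceptProb ((F.fresh sec (s.target + 1)).bind fun π =>
        (S.run sec s.target B I π).bind fun o =>
          (idealTranscript S sec qs (next π o.2)).map fun T => P ++ ([x, z, o.1] ++ T))
            (transcriptTest C)| ≤ qs.length * (εP + εS) := by
      refine abs_acceptProb_bind_sub_le _ _ _ _ _ fun π _ => ?_
      refine abs_acceptProb_bind_sub_le _ _ _ _ _ fun o _ => ?_
      have := ih (next π o.2) (hs.next a π o.2) (P ++ [x, z, o.1])
      simpa only [List.append_assoc] using this
    -- In the ideal world the future does not depend on the output of the shuffle.
    have h1' : ((F.fresh sec (s.target + 1)).bind fun π =>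
        (S.run sec s.target B I π).bind fun o =>
          (idealTranscript S sec qs (next π o.2)).map fun T => P ++ ([x, z, o.1] ++ T)) =
        (F.fresh sec (s.target + 1)).bind fun π =>
          ((S.run sec s.target B I π).map Prod.fst).bind fun tr =>
            (idealTranscript S sec qs (next π fun _ => none)).map fun T =>
              P ++ ([x, z, tr] ++ T) := by
      simp only [PMF.bind_map]
      refine congrArg (PMF.bind _) (funext fun π => congrArg (PMF.bind _) (funext fun o => ?_))
      have := idealTranscript_withTable S sec qs (next π fun _ => none)
        (Function.update s.table s.target o.2)
      dsimp only [Function.comp_apply]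
      rw [← this]
      rfl
    rw [h1'] at h1
    -- The trace of the shuffle is replaced by that of an input of dummies.
    have h2 : |acceptProb ((F.fresh sec (s.target + 1)).bind fun π =>
          ((S.run sec s.target B I π).map Prod.fst).bind fun tr =>
            (idealTranscript S sec qs (next π fun _ => none)).map fun T =>
              P ++ ([x, z, tr] ++ T)) (transcriptTest C) -
        acceptProb ((F.fresh sec (s.target + 1)).bind fun π =>
          (simulatedShuffle S sec s.target B n).bind fun tr =>
            (idealTranscript S sec qs (next π fun _ => none)).map fun T =>
              P ++ ([x, z, tr] ++ T)) (transcriptTest C)| ≤ εS := by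
      refine abs_acceptProb_bind_sub_le _ _ _ _ _ fun π _ => ?_
      exact abs_sub_le_of_shuffleSecure hS hC hl π (Equiv.refl _) (hs.shuffleInput_valid a data)
        (valid_replicate_none (hs.length_evictAll_lt a)) (by simpa using hIn) P x z _
    -- The permutation is replaced by a uniformly random one.
    have h3 : |acceptProb ((F.fresh sec (s.target + 1)).bind fun π =>
          (simulatedShuffle S sec s.target B n).bind fun tr =>
            (idealTranscript S sec qs (next π fun _ => none)).map fun T =>
              P ++ ([x, z, tr] ++ T)) (transcriptTest C) -
        acceptProb ((PMF.uniformOfFintype (Equiv.Perm (Fin (2 ^ (s.target + 1))))).bind fun π =>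
          (simulatedShuffle S sec s.target B n).bind fun tr =>
            (idealTranscript S sec qs (next π fun _ => none)).map fun T =>
              P ++ ([x, z, tr] ++ T)) (transcriptTest C)| ≤ εP := by
      obtain ⟨μ, hμ, hμ'⟩ := idealTranscript_mixture S sec hl qs
        (next (Equiv.refl _) fun _ => none)
      have hnext : ∀ π, (next (Equiv.refl _) fun _ => none).withPerm s.target π =
          next π fun _ => none := by
        intro π
        simp only [next, State.withPerm, State.afterRebuild, Function.update_idem]
      simp only [hnext] at hμ'
      have h := abs_sub_le_of_permSecure hP hC (Nat.add_le_add_right hl 1)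
        ((simulatedShuffle S sec s.target B n).bind fun tr => μ.map fun g π =>
          P ++ ([x, z, tr] ++ g π)) (by
            intro g hg
            obtain ⟨tr, -, hg⟩ := (PMF.mem_support_bind_iff _ _ _).1 hg
            obtain ⟨g', hg', rfl⟩ := (PMF.mem_support_map_iff _ _ _).1 hg
            have h1 := one_le_traceBound L
            exact .append h1 P (.append h1 [x, z, tr] (hμ g' hg')))
      simp only [PMF.map_bind, PMF.map_comp] at h
      simp only [hμ', PMF.map_comp]
      exact h
    rw [hreal, hideal]
    have h4 := (abs_sub_le _ _ _).trans 
      (add_le_add ((abs_sub_le _ _ _).trans (add_le_add h1 h2)) h3)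
    refine h4.trans (le_of_eq ?_)
    push_cast [List.length_cons]
    ring

theorem abs_accessPattern_sub_idealPattern_le (hP : PermSecure F sec L m εP)
    (hS : ShuffleSecure S sec L B m εS) (hC : C.length * (traceBound L + 1) + 5 ≤ m)
    (db : Addr L → Data B) (y : List (Request L B)) :
    |acceptProb (accessPattern F S sec db y) (transcriptTest C) -
      acceptProb (idealPattern S sec db y) (transcriptTest C)| ≤
        y.length * (εP + εS) + εP := by
  have h1 : |acceptProb (accessPattern F S sec db y) (transcriptTest C) -
      acceptProb ((F.fresh sec (L + 1)).bind fun π => idealTranscript S sec y (init π db))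
        (transcriptTest C)| ≤ y.length * (εP + εS) := by
    refine abs_acceptProb_bind_sub_le _ _ _ _ _ fun π _ => ?_
    have h := abs_transcript_sub_idealTranscript_le hP hS hC y _ (wellFormed_init π db) []
    simp only [List.nil_append] at h
    rwa [show (fun T : Transcript => T) = id from rfl, PMF.map_id, PMF.map_id] at h
  obtain ⟨μ, hμ, hμ'⟩ := idealTranscript_mixture S sec le_rfl y (init (Equiv.refl _) db)
  have hinit : ∀ π, idealTranscript S sec y (init π db) = μ.map fun g => g π := by
    intro π
    rw [← hμ', ← idealTranscript_withTable S sec y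
      ((init (Equiv.refl _) db).withPerm L π) (init π db).table]
    congr 1
    simp only [init, State.withPerm, Function.update_idem]
  have h2 := abs_sub_le_of_permSecure hP hC le_rfl μ hμ
  simp only [← hinit] at h2
  exact (abs_sub_le _ _ _).trans (add_le_add h1 h2)

end Hybrid

end RankORAM

/-! ### The ideal world is oblivious -/

namespace RankORAM

variable {L B : ℕ}

/-- The positions of level `j` that a sequence of requests probes before level `j` is merged into a
rebuilt level. They depend on the dictionaries and counters only, and so the permutation and the
table of the next state are arbitrary. -/
def futureProbes (j : ℕ) : State L B → List (Request L B) → List (Fin (2 ^ (j + 1)))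
  | _, [] => []
  | s, q :: qs => s.probe q.addr j :: if j ≤ s.target then [] else
      futureProbes j ((s.afterQuery q.addr).afterRebuild q.addr s.target (Equiv.refl _)
        fun _ => none) qs

theorem futureProbes_congr (j : ℕ) (y : List (Request L B)) (s : State L B)
    (p : ∀ l : ℕ, Equiv.Perm (Fin (2 ^ (l + 1)))) (tb : ℕ → ℕ → Option (Data B)) :
    futureProbes j { s with perm := p, table := tb } y = futureProbes j s y := by
  induction y generalizing s p tb with
  | nil => rfl
  | cons q qs ih =>
    simp only [futureProbes]
    have h : futureProbes j (((State.afterQuery { s with perm := p, table := tb }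
        q.addr)).afterRebuild q.addr s.target (Equiv.refl _) fun _ => none) qs =
        futureProbes j ((s.afterQuery q.addr).afterRebuild q.addr s.target (Equiv.refl _)
          fun _ => none) qs :=
      ih ((s.afterQuery q.addr).afterRebuild q.addr s.target (Equiv.refl _) fun _ => none)
        (Function.update p s.target (Equiv.refl _)) (Function.update tb s.target fun _ => none)
    rw [← h]
    rfl

theorem futureProbes_cons (j : ℕ) (q : Request L B) (qs : List (Request L B)) (s : State L B)
    (π : Equiv.Perm (Fin (2 ^ (s.target + 1)))) (out : ℕ → Option (Data B)) :
    futureProbes j s (q :: qs) = s.probe q.addr j :: if j ≤ s.target then [] else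
      futureProbes j ((s.afterQuery q.addr).afterRebuild q.addr s.target π out) qs := by
  rw [futureProbes]
  have h := futureProbes_congr j qs ((s.afterQuery q.addr).afterRebuild q.addr s.target
    (Equiv.refl _) fun _ => none) (Function.update s.perm s.target π)
      (Function.update s.table s.target out)
  rw [← h]
  rfl

theorem nodup_futureProbes (j : ℕ) (y : List (Request L B)) (s : State L B)
    (hs : s.WellFormed) (hj : j ∈ s.occupied) :
    (futureProbes j s y).Nodup ∧ ∀ r ∈ futureProbes j s y, r ∉ s.touched j := by
  induction y generalizing s with
  | nil => simp [futureProbes]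
  | cons q qs ih =>
    rw [futureProbes]
    have hp := hs.probe_notMem_touched q.addr hj
    split_ifs with h
    · simpa using hp
    · have hlt := not_le.1 h
      obtain ⟨h1, h2⟩ := ih _ (hs.next q.addr (Equiv.refl _) fun _ => none)
        (Finset.mem_insert_of_mem (Finset.mem_filter.2 ⟨hj, hlt⟩))
      rw [hs.touched_next q.addr _ _ hj hlt] at h2
      refine ⟨List.nodup_cons.2 ⟨fun hm => h2 _ hm (Finset.mem_insert_self _ _), h1⟩, ?_⟩
      intro r hr
      rcases List.mem_cons.1 hr with rfl | hr
      · exact hp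
      · exact fun hm => h2 r hr (Finset.mem_insert_of_mem hm)

theorem State.target_congr {s t : State L B} (h : s.occupied = t.occupied) :
    s.target = t.target := by
  rw [State.target, State.target, h]

theorem length_futureProbes_congr (j : ℕ) (y z : List (Request L B)) (s t : State L B)
    (hyz : y.length = z.length) (hst : s.occupied = t.occupied) :
    (futureProbes j s y).length = (futureProbes j t z).length := by
  induction y generalizing z s t with
  | nil =>
    obtain rfl := List.length_eq_zero_iff.1 hyz.symm
    rfl
  | cons q qs ih =>
    cases z with
    | nil => simp at hyz
    | cons q' qs' =>
      have ht := State.target_congr hst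
      rw [futureProbes, futureProbes, List.length_cons, List.length_cons]
      by_cases h : j ≤ s.target
      · rw [if_pos h, if_pos (ht ▸ h)]
      · rw [if_neg h, if_neg (ht ▸ h)]
        congr 1
        refine ih qs' _ _ (by simpa using hyz) ?_
        change insert s.target (s.occupied.filter (s.target < ·)) =
          insert t.target (t.occupied.filter (t.target < ·))
        rw [hst, ht]

/-- Two lists without repetitions and of the same length are related by a permutation. -/
theorem exists_perm_map_eq {α : Type} {u v : List α} (hu : u.Nodup) (hv : v.Nodup)
    (h : u.length = v.length) : ∃ e : Equiv.Perm α, u.map e = v := by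
  obtain ⟨e, he⟩ := (Equiv.Perm.isMultiplyPretransitive α u.length).exists_smul_eq
    ⟨u.get, List.nodup_iff_injective_get.1 hu⟩
    ⟨fun i => v.get (i.cast h), fun i j hij => by
      simpa using List.nodup_iff_injective_get.1 hv hij⟩
  refine ⟨e, List.ext_getElem (by simpa using h) fun i h1 h2 => ?_⟩
  have := DFunLike.congr_fun he ⟨i, by simpa using h1⟩
  simpa using this

theorem uniform_bind_mul_right {α β : Type} [Fintype α] [DecidableEq α] (e : Equiv.Perm α)
    (k : Equiv.Perm α → PMF β) :
    ((PMF.uniformOfFintype (Equiv.Perm α)).bind fun π => k (π * e)) =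
      (PMF.uniformOfFintype (Equiv.Perm α)).bind k := by
  ext b
  simp only [PMF.bind_apply, PMF.uniformOfFintype_apply]
  exact (Equiv.mulRight e).tsum_eq fun π => (Fintype.card (Equiv.Perm α) : ENNReal)⁻¹ * k π b

/-- In two states with the same occupied levels, the transcripts of two request sequences have the
same distribution if the permutations of each level show the same probed cells, in the past and in
the future. Fresh uniform permutations are coupled in such a way that this remains true. -/
theorem idealTranscript_congr (S : ShuffleAlg) (sec : ℕ) (y z : List (Request L B))
    (s t : State L B) (hyz : y.length = z.length) (hs : s.WellFormed) (ht : t.WellFormed)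
    (hocc : s.occupied = t.occupied)
    (hpast : ∀ j ∈ s.occupied,
      (s.touched j).map (s.perm j).toEmbedding = (t.touched j).map (t.perm j).toEmbedding)
    (hfut : ∀ j ∈ s.occupied,
      (futureProbes j s y).map (s.perm j) = (futureProbes j t z).map (t.perm j)) :
    idealTranscript S sec y s = idealTranscript S sec z t := by
  induction y generalizing z s t with
  | nil =>
    obtain rfl := List.length_eq_zero_iff.1 hyz.symm
    rfl
  | cons q qs ih =>
    cases z with
    | nil => simp at hyz
    | cons q' qs' =>
      have hlen : qs.length = qs'.length := by simpa using hyz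
      have hprobe : ∀ j ∈ s.occupied,
          s.perm j (s.probe q.addr j) = t.perm j (t.probe q'.addr j) := fun j hj => by
        have := hfut j hj
        rw [futureProbes, futureProbes, List.map_cons, List.map_cons] at this
        exact (List.cons.inj this).1
      have hquery : s.queryTrace q.addr = t.queryTrace q'.addr := by
        rw [State.queryTrace, State.queryTrace, State.query_eq, State.query_eq, ← hocc]
        congr 1
        refine List.map_congr_left fun j hj => ?_
        rw [hprobe j ((Finset.mem_sort _).1 hj)]
      have hins : ∀ j ∈ s.occupied,
          (insert (s.probe q.addr j) (s.touched j)).map (s.perm j).toEmbedding =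
            (insert (t.probe q'.addr j) (t.touched j)).map (t.perm j).toEmbedding := by
        intro j hj
        rw [Finset.map_insert, Finset.map_insert, hpast j hj]
        congr 1
        exact hprobe j hj
      have hmoved : ∀ l, ((s.afterQuery q.addr).candidates l).filter
          ((s.afterQuery q.addr).moved q.addr) =
            ((t.afterQuery q'.addr).candidates l).filter
              ((t.afterQuery q'.addr).moved q'.addr) := by
        intro l
        have hcand : (t.afterQuery q'.addr).candidates l = (s.afterQuery q.addr).candidates l := by
          simp only [State.candidates, State.sources, State.afterQuery, hocc]
        rw [hcand]
        refine List.filter_congr fun c hc => ?_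
        obtain ⟨j, hj, hc⟩ := List.mem_flatMap.1 hc
        have hj : j ∈ s.occupied := (Finset.mem_filter.1 ((Finset.mem_sort _).1 hj)).1
        obtain ⟨i, -, rfl⟩ := List.mem_map.1 hc
        rw [Bool.eq_iff_iff]
        dsimp only [State.moved]
        rw [hs.kept_iff q.addr hj, ht.kept_iff q'.addr (hocc ▸ hj), not_iff_not]
        change (s.perm j).symm _ ∈ _ ↔ (t.perm j).symm _ ∈ _
        rw [← Finset.mem_map_equiv, ← Finset.mem_map_equiv, hins j hj]
      obtain ⟨l, hl⟩ : ∃ l, l = s.target := ⟨_, rfl⟩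
      have hl' : l = t.target := hl.trans (State.target_congr hocc)
      have hcons : ∀ (q : Request L B) (qs : List (Request L B)) (s : State L B),
          l = s.target → idealTranscript S sec (q :: qs) s =
            (PMF.uniformOfFintype (Equiv.Perm (Fin (2 ^ (l + 1))))).bind fun π =>
              (simulatedShuffle S sec l B (((s.afterQuery q.addr).evictAll q.addr l).length +
                1)).bind fun tr => (idealTranscript S sec qs
                  ((s.afterQuery q.addr).afterRebuild q.addr l π fun _ => none)).map fun T =>
                    [s.queryTrace q.addr, (s.afterQuery q.addr).evictTrace q.addr l, tr] ++ T := by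
        rintro q qs s rfl
        rfl
      rw [hcons q qs s hl, hcons q' qs' t hl']
      simp only [State.length_evictAll, State.evictTrace_eq, hmoved, hquery]
      set nexts := fun π : Equiv.Perm (Fin (2 ^ (l + 1))) =>
        (s.afterQuery q.addr).afterRebuild q.addr l π fun _ => none with hnexts
      set nextt := fun π : Equiv.Perm (Fin (2 ^ (l + 1))) =>
        (t.afterQuery q'.addr).afterRebuild q'.addr l π fun _ => none with hnextt
      have hws : ∀ π, (nexts π).WellFormed := by
        subst hl
        exact fun π => hs.next q.addr π _
      have hwt : ∀ π, (nextt π).WellFormed := by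
        subst hl'
        exact fun π => ht.next q'.addr π _
      have hocc' : ∀ π π', (nexts π).occupied = (nextt π').occupied := fun π π' => by
        simp only [hnexts, hnextt, State.afterRebuild, State.afterQuery, hocc]
      have hmem : ∀ π, l ∈ (nexts π).occupied := fun π => Finset.mem_insert_self _ _
      -- The coupling of the two fresh permutations of level `l`.
      obtain ⟨e, he⟩ := exists_perm_map_eq
        (nodup_futureProbes l qs' (nextt (Equiv.refl _)) (hwt _) (hocc' 1 _ ▸ hmem 1)).1
        (nodup_futureProbes l qs (nexts (Equiv.refl _)) (hws _) (hmem _)).1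
        (length_futureProbes_congr l _ _ _ _ hlen.symm (hocc' _ _).symm)
      have hfs : ∀ j π, futureProbes j (nexts π) qs =
          futureProbes j (nexts (Equiv.refl _)) qs := fun j π =>
        futureProbes_congr j qs (nexts (Equiv.refl _)) (Function.update s.perm l π)
          (nexts (Equiv.refl _)).table
      have hft : ∀ j π, futureProbes j (nextt π) qs' =
          futureProbes j (nextt (Equiv.refl _)) qs' := fun j π =>
        futureProbes_congr j qs' (nextt (Equiv.refl _)) (Function.update t.perm l π)
          (nextt (Equiv.refl _)).table
      have key : ∀ π, idealTranscript S sec qs (nexts π) =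
          idealTranscript S sec qs' (nextt (π * e)) := by
        intro π
        have hperml : (nexts π).perm l = π := Function.update_self ..
        have hperml' : (nextt (π * e)).perm l = π * e := Function.update_self ..
        have hpermj : ∀ j, l < j → (nexts π).perm j = s.perm j := fun j hj =>
          Function.update_of_ne hj.ne' ..
        have hpermj' : ∀ j, l < j → (nextt (π * e)).perm j = t.perm j := fun j hj =>
          Function.update_of_ne hj.ne' ..
        refine ih qs' (nexts π) (nextt (π * e)) hlen (hws π) (hwt _) (hocc' _ _) ?_ ?_
        · intro j hj
          rcases Finset.mem_insert.1 hj with rfl | hmj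
          · have h1 : (nexts π).touched j = ∅ := by
              subst hl
              exact State.WellFormed.touched_next_target _ _ _
            have h2 : (nextt (π * e)).touched j = ∅ := by
              subst hl'
              exact State.WellFormed.touched_next_target _ _ _
            rw [h1, h2, Finset.map_empty, Finset.map_empty]
          · obtain ⟨hjo, hlj⟩ : j ∈ s.occupied ∧ l < j := Finset.mem_filter.1 hmj
            have h1 : (nexts π).touched j = insert (s.probe q.addr j) (s.touched j) := by
              subst hl
              exact hs.touched_next q.addr _ _ hjo hlj
            have h2 : (nextt (π * e)).touched j =
                insert (t.probe q'.addr j) (t.touched j) := by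
              subst hl'
              exact ht.touched_next q'.addr _ _ (hocc ▸ hjo) hlj
            rw [h1, h2, hpermj j hlj, hpermj' j hlj]
            exact hins j hjo
        · intro j hj
          rcases Finset.mem_insert.1 hj with rfl | hmj
          · rw [hperml, hperml', hfs, hft, ← he, List.map_map]
            rfl
          · obtain ⟨hjo, hlj⟩ : j ∈ s.occupied ∧ l < j := Finset.mem_filter.1 hmj
            have h1 := hfut j hjo
            have h2 : futureProbes j s (q :: qs) =
                s.probe q.addr j :: futureProbes j (nexts π) qs := by
              subst hl
              rw [futureProbes_cons j q qs s π fun _ => none, if_neg (not_le.2 hlj)]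
            have h3 : futureProbes j t (q' :: qs') =
                t.probe q'.addr j :: futureProbes j (nextt (π * e)) qs' := by
              subst hl'
              rw [futureProbes_cons j q' qs' t (π * e) fun _ => none, if_neg (not_le.2 hlj)]
            rw [h2, h3, List.map_cons, List.map_cons] at h1
            rw [hpermj j hlj, hpermj' j hlj]
            exact (List.cons.inj h1).2
      let X := ((t.afterQuery q'.addr).candidates l).filter ((t.afterQuery q'.addr).moved q'.addr)
      let K : PMF Transcript → PMF Transcript := fun p =>
        (simulatedShuffle S sec l B (X.length + 1)).bind fun tr =>
          p.map fun T => [t.queryTrace q'.addr, moveTrace X, tr] ++ T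
      change ((PMF.uniformOfFintype _).bind fun π => K (idealTranscript S sec qs (nexts π))) =
        (PMF.uniformOfFintype _).bind fun π => K (idealTranscript S sec qs' (nextt π))
      simp only [key]
      exact uniform_bind_mul_right e fun π => K (idealTranscript S sec qs' (nextt π))

/-- In the ideal world the access patterns of request sequences of the same length are identically
distributed. -/
theorem idealPattern_congr (S : ShuffleAlg) (sec : ℕ) (db : Addr L → Data B)
    (y z : List (Request L B)) (hyz : y.length = z.length) :
    idealPattern S sec db y = idealPattern S sec db z := by
  obtain ⟨e, he⟩ := exists_perm_map_eq
    (nodup_futureProbes L z _ (wellFormed_init (Equiv.refl _) db)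
      (wellFormed_init _ db).top_mem).1
    (nodup_futureProbes L y _ (wellFormed_init (Equiv.refl _) db)
      (wellFormed_init _ db).top_mem).1
    (length_futureProbes_congr L _ _ _ _ hyz.symm rfl)
  have hf : ∀ (x : List (Request L B)) π, futureProbes L (init π db) x =
      futureProbes L (init (Equiv.refl _) db) x := fun x π =>
    futureProbes_congr L x (init (Equiv.refl _) db) (init π db).perm (init π db).table
  have hperm : ∀ π, (init π db).perm L = π := fun π => by simp [init]
  have key : ∀ π, idealTranscript S sec y (init π db) =
      idealTranscript S sec z (init (π * e) db) := by
    intro π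
    refine idealTranscript_congr S sec y z _ _ hyz (wellFormed_init π db)
      (wellFormed_init _ db) rfl ?_ ?_
    · intro j hj
      obtain rfl := Finset.mem_singleton.1 hj
      rw [touched_init, touched_init, Finset.map_empty, Finset.map_empty]
    · intro j hj
      obtain rfl := Finset.mem_singleton.1 hj
      rw [hperm, hperm, hf y π, hf z (π * e), ← he, List.map_map]
      rfl
  simp only [idealPattern, key]
  exact uniform_bind_mul_right e fun π => idealTranscript S sec z (init π db)

end RankORAM

/-! ### Obliviousness of RankORAM -/

namespace RankORAM

theorem polyBounded_traceBound {L : ℕ → ℕ} (hL : PolyBounded fun sec => 2 ^ L sec) :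
    PolyBounded fun sec => traceBound (L sec) := by
  have h1 : PolyBounded L := hL.mono fun n => Nat.lt_two_pow_self.le
  have h2 : PolyBounded fun sec => 2 ^ (L sec + 1) :=
    (hL.mul (.const 2)).mono fun n => (pow_succ 2 (L n)).le
  have h3 : PolyBounded fun sec => L sec + 1 := h1.add (.const 1)
  have h4 : PolyBounded fun sec => cellBound (L sec) := h3.mul h2
  have h5 : PolyBounded fun sec => flagBound (L sec) :=
    (h2.mul ((h3.mul (.const 5)).add (.const 5))).add (.const 1)
  exact (h4.mul ((h5.add ((PolyBounded.const 4).mul (h4.add (.const 1)))).add (.const 2))).add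
    (.const 2)

theorem exists_permSecure {F : PermFamily} (hF : F.IsPseudorandom) {L m : ℕ → ℕ}
    (hL : PolyBounded L) (hm : PolyBounded m) :
    ∃ ε : ℕ → ℝ, Negligible ε ∧ (∀ n, 0 ≤ ε n) ∧ ∀ n, PermSecure F n (L n) (m n) (ε n) := by
  obtain ⟨ε, h1, h2, h3⟩ := exists_negligible_bound
    (ι := fun n => {x : ℕ × Circuit Empty Unit // x.1 ≤ L n + 1 ∧ x.2.length ≤ m n})
    (hι := fun n => ⟨⟨(0, []), by simp⟩⟩)
    (fun n x => |acceptProb (F.fresh n x.1.1)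
        (fun π => x.1.2.eval (fun i => i.elim) (permOracle π)) -
      acceptProb (PMF.uniformOfFintype (Equiv.Perm (Fin (2 ^ x.1.1))))
        (fun π => x.1.2.eval (fun i => i.elim) (permOracle π))|)
    (fun n x => abs_nonneg _) (fun n x => abs_acceptProb_sub_le_one _ _ _ _)
    (fun c => hF (fun n => (c n).1.1) ((hL.add (.const 1)).mono fun n => (c n).2.1)
      (fun n => (c n).1.2) (hm.mono fun n => (c n).2.2))
  exact ⟨ε, h1, h2, fun n d hd D hD => h3 n ⟨(d, D), hd, hD⟩⟩

/-- The parameters of the security game of a shuffle: table size, two inputs with permutations, and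
a distinguisher. -/
structure ShuffleGame (L B m : ℕ) where
  l : ℕ
  hl : l ≤ L
  I : ShuffleInput l B
  J : ShuffleInput l B
  π : Equiv.Perm (Fin (2 ^ (l + 1)))
  ρ : Equiv.Perm (Fin (2 ^ (l + 1)))
  hI : I.Valid
  hJ : J.Valid
  hIJ : I.length = J.length
  D : Circuit TraceBit Empty
  hD : D.length ≤ m

theorem exists_shuffleSecure {S : ShuffleAlg} (hS : S.IsOblivious) {L m : ℕ → ℕ} (B : ℕ → ℕ)
    (hL : PolyBounded fun sec => 2 ^ L sec) (hm : PolyBounded m) :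
    ∃ ε : ℕ → ℝ, Negligible ε ∧ (∀ n, 0 ≤ ε n) ∧
      ∀ n, ShuffleSecure S n (L n) (B n) (m n) (ε n) := by
  obtain ⟨ε, h1, h2, h3⟩ := exists_negligible_bound
    (ι := fun n => ShuffleGame (L n) (B n) (m n))
    (hι := fun n => ⟨⟨0, Nat.zero_le _, [], [], 1, 1, by simp [ShuffleInput.Valid],
      by simp [ShuffleInput.Valid], rfl, [], Nat.zero_le _⟩⟩)
    (fun n g => |acceptProb ((S.run n g.l (B n) g.I g.π).map Prod.fst)
        (fun tr => g.D.eval (traceBits tr) fun o => o.elim) -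
      acceptProb ((S.run n g.l (B n) g.J g.ρ).map Prod.fst)
        (fun tr => g.D.eval (traceBits tr) fun o => o.elim)|)
    (fun n g => abs_nonneg _) (fun n g => abs_acceptProb_sub_le_one _ _ _ _)
    (fun c => hS (fun n => (c n).l) B
      (hL.mono fun n => Nat.pow_le_pow_right two_pos (c n).hl) (fun n => (c n).I)
      (fun n => (c n).J) (fun n => (c n).π) (fun n => (c n).ρ) (fun n => (c n).hI)
      (fun n => (c n).hJ) (fun n => (c n).hIJ) (fun n => (c n).D) (hm.mono fun n => (c n).hD))
  exact ⟨ε, h1, h2, fun n l hl I J π ρ hI hJ hIJ D hD =>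
    h3 n ⟨l, hl, I, J, π, ρ, hI, hJ, hIJ, D, hD⟩⟩

theorem isObliviousRAM {F : PermFamily} (hF : F.IsPseudorandom) {S : ShuffleAlg}
    (hS : S.IsOblivious) (L B : ℕ → ℕ) (hL : PolyBounded fun sec => 2 ^ L sec)
    (db : ∀ sec, Addr (L sec) → Data (B sec)) :
    IsObliviousRAM fun sec y => accessPattern F S sec (db sec) y := by
  intro y z hyz hy C hC
  have hm : PolyBounded fun n => (C n).length * (traceBound (L n) + 1) + 5 :=
    (hC.mul ((polyBounded_traceBound hL).add (.const 1))).add (.const 5)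
  obtain ⟨εP, hP, hP0, hPs⟩ := exists_permSecure hF
    (hL.mono fun n => Nat.lt_two_pow_self.le) hm
  obtain ⟨εS, hS, hS0, hSs⟩ := exists_shuffleSecure hS B hL hm
  have hneg : Negligible fun n => ((y n).length : ℝ) * (εP n + εS n) + εP n :=
    (hy.mul_negligible (fun n => add_nonneg (hP0 n) (hS0 n)) (hP.add hS)).add hP
  refine (hneg.add hneg).mono (fun n => abs_nonneg _) fun n => ?_
  have h1 := abs_accessPattern_sub_idealPattern_le (C := C n) (hPs n) (hSs n) le_rfl (db n) (y n)
  have h2 := abs_accessPattern_sub_idealPattern_le (C := C n) (hPs n) (hSs n) le_rfl (db n) (z n)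
  rw [← idealPattern_congr S n (db n) (y n) (z n) (hyz n), ← hyz n, abs_sub_comm] at h2
  exact (abs_sub_le _ _ _).trans (add_le_add h1 h2)

end RankORAM

theorem mainTheorem2 (F : PermFamily) (hF : F.IsPseudorandom) (L B : ℕ → ℕ)
    (hL : PolyBounded fun sec => 2 ^ L sec) (db : ∀ sec, Addr (L sec) → Data (B sec)) :
    (∀ S : ShuffleAlg, S.IsOblivious →
      IsObliviousRAM fun sec y => RankORAM.accessPattern F S sec (db sec) y) ∧
    IsObliviousRAM fun sec y => RankORAM.accessPattern F shortQueueShuffle sec (db sec) y :=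
  ⟨fun _ hS => RankORAM.isObliviousRAM hF hS L B hL db,
    RankORAM.isObliviousRAM hF shortQueueShuffle_isOblivious L B hL db⟩
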